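/- **Theorem 1.** Let $(\tau, V_\tau)$ be an irreducible unitary (strongly continuous) representation of $SO(3)$ on a finite-dimensional complex inner product space $V_\tau$; up to equivalence, $\tau=\tau_m$ for some integer $m\ge 0$. Let $SO(3)$ act on smooth functions $u:\mathbb{R}^3\to V_\tau$ by $(k\cdot u)(x)=\tau(k)\,u(k^{-1}x)$, and let $(\mathbb{D}(\mathbb{R}^3)\otimes \mathrm{End}(V_\tau))^{SO(3)}$ be the complex algebra of all linear differential operators on $C^\infty(\mathbb{R}^3,V_\tau)$ (with smooth $\mathrm{End}(V_\tau)$-valued coefficients) that commute with all translations and with this action of $SO(3)$. Let $d\tau(Y)=\frac{d}{dt}\big|_{t=0}\tau(\exp tY)$ for $Y\in so(3)$, and let $$Y_1=\begin{pmatrix}0&0&0\\0&0&1\\0&-1&0\end{pmatrix},\quad Y_2=\begin{pmatrix}0&0&-1\\0&0&0\\1&0&0\end{pmatrix},\quad Y_3=\begin{pmatrix}0&1&0\\-1&0&0\\0&0&0\end{pmatrix}.$$ Then the algebra $(\mathbb{D}(\mathbb{R}^3)\otimes \mathrm{End}(V_\tau))^{SO(3)}$ is generated, as a unital algebra over $\mathbb{C}$,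 by the two operators $\Delta\otimes I$ and $D_\tau=\sum_{i=1}^3 \frac{\partial}{\partial x_i}\, d\tau(Y_i)$, where $\Delta$ is the Laplacian on $\mathbb{R}^3$, acting on $V_\tau$-valued functions. -/

import Mathlib

open scoped ContDiff

noncomputable section

namespace EuclideanMotion

/-- Euclidean space `ℝ³`. -/
abbrev E3 : Type := EuclideanSpace ℝ (Fin 3)

/-- The rotation group `SO(3)`, with its topology as a group of matrices. -/
abbrev SO3 : Type := Matrix.specialOrthogonalGroup (Fin 3) ℝ

/-- The natural action of `SO(3)` on `ℝ³`. -/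
def rotate (k : SO3) : E3 →L[ℝ] E3 := Matrix.toEuclideanCLM (n := Fin 3) (𝕜 := ℝ) k.1

/-! ### The Lie algebra `so(3)` and the exponential map -/

/-- The Lie algebra `so(3)` of skew-symmetric real `3 × 3` matrices (as a real vector space; the
bracket is not needed here). -/
def so3 : Submodule ℝ (Matrix (Fin 3) (Fin 3) ℝ) where
  carrier := {Y | Y.transpose = -Y}
  add_mem' := fun {A B} (hA : A.transpose = -A) (hB : B.transpose = -B) => by
    change (A + B).transpose = -(A + B)
    rw [Matrix.transpose_add, hA, hB, neg_add]
  zero_mem' := by simp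
  smul_mem' := fun c A (hA : A.transpose = -A) => by
    change (c • A).transpose = -(c • A)
    rw [Matrix.transpose_smul, hA, smul_neg]

lemma exp_mem_orthogonalGroup (Y : Matrix (Fin 3) (Fin 3) ℝ) (hY : Y.transpose = -Y) :
    NormedSpace.exp Y ∈ Matrix.orthogonalGroup (Fin 3) ℝ := by
  rw [Matrix.mem_orthogonalGroup_iff, ← Matrix.exp_transpose, hY,
    ← Matrix.exp_add_of_commute _ _ (Commute.neg_right (Commute.refl Y)), add_neg_cancel,
    NormedSpace.exp_zero]

lemma exp_mem_specialOrthogonalGroup (Y : Matrix (Fin 3) (Fin 3) ℝ) (hY : Y.transpose = -Y) :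
    NormedSpace.exp Y ∈ Matrix.specialOrthogonalGroup (Fin 3) ℝ := by
  refine Matrix.mem_specialOrthogonalGroup_iff.2 ⟨exp_mem_orthogonalGroup Y hY, ?_⟩
  have hZ : ((1 / 2 : ℝ) • Y).transpose = -((1 / 2 : ℝ) • Y) := by
    rw [Matrix.transpose_smul, hY, smul_neg]
  have h1 := (Matrix.mem_orthogonalGroup_iff (Fin 3) ℝ).1 (exp_mem_orthogonalGroup _ hZ)
  have h2 : NormedSpace.exp Y
      = NormedSpace.exp ((1 / 2 : ℝ) • Y) * NormedSpace.exp ((1 / 2 : ℝ) • Y) := by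
    rw [← Matrix.exp_add_of_commute _ _ (Commute.refl _), ← add_smul]
    norm_num
  have h3 := congrArg Matrix.det h1
  rw [Matrix.det_mul, Matrix.det_transpose, Matrix.det_one] at h3
  rw [h2, Matrix.det_mul, h3]

/-- The exponential map `so(3) → SO(3)` (the matrix exponential). -/
def expSO3 (Y : so3) : SO3 :=
  ⟨NormedSpace.exp Y.1, exp_mem_specialOrthogonalGroup Y.1 Y.2⟩

/-- The canonical basis matrices `Y₁, Y₂, Y₃` of `so(3)` (indexed by `0, 1, 2`). -/
def basisMatrix : Fin 3 → Matrix (Fin 3) (Fin 3) ℝ :=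
  ![!![0, 0, 0; 0, 0, 1; 0, -1, 0], !![0, 0, -1; 0, 0, 0; 1, 0, 0], !![0, 1, 0; -1, 0, 0; 0, 0, 0]]

/-- The canonical basis `Y₁, Y₂, Y₃` of `so(3)`, as elements of the Lie algebra. -/
def basisY (i : Fin 3) : so3 :=
  ⟨basisMatrix i, by
    change (basisMatrix i).transpose = -basisMatrix i
    fin_cases i <;> ext a b <;> fin_cases a <;> fin_cases b <;> simp [basisMatrix]⟩

/-! ### Representations -/

variable {V : Type*} [NormedAddCommGroup V] [InnerProductSpace ℂ V]

/-- `τ` is an irreducible unitary representation of `SO(3)`: strongly continuous, by unitary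
operators, and irreducible (which includes `V ≠ 0`). -/
structure IsIrreducibleUnitary (τ : Representation ℂ SO3 V) : Prop where
  continuous : ∀ v : V, Continuous fun k : SO3 => τ k v
  unitary : ∀ (k : SO3) (v w : V), inner ℂ (τ k v) (τ k w) = inner ℂ v w
  irreducible : τ.IsIrreducible

/-- The operator `τ(k)` as a continuous linear map (`V` is finite-dimensional). -/
def opOf [FiniteDimensional ℂ V] (τ : Representation ℂ SO3 V) (k : SO3) : V →L[ℂ] V :=
  LinearMap.toContinuousLinearMap (τ k)

/-- The derived representation, `dτ(Y) = d/dt τ(exp(tY))` at `t = 0`. The derivative exists for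
every continuous `τ`, because `t ↦ τ(exp(tY))` is then a continuous one-parameter group of
operators of a finite-dimensional space. -/
def derivedRep [FiniteDimensional ℂ V] (τ : Representation ℂ SO3 V) (Y : so3) : V →L[ℂ] V :=
  deriv (fun t : ℝ => opOf τ (expSO3 (t • Y))) 0

/-! ### Smooth vector-valued functions and operators on them -/

variable (V) in
/-- The space `C^∞(ℝ³, V)`. -/
def SmoothFun : Submodule ℂ (E3 → V) where
  carrier := {u | ContDiff ℝ ∞ u}
  add_mem' := fun {u v} (hu : ContDiff ℝ ∞ u) (hv : ContDiff ℝ ∞ v) => hu.add hv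
  zero_mem' := (contDiff_const : ContDiff ℝ ∞ fun _ : E3 => (0 : V))
  smul_mem' := fun c u (hu : ContDiff ℝ ∞ u) => hu.const_smul c

lemma SmoothFun.contDiff (u : SmoothFun V) : ContDiff ℝ ∞ u.1 := u.2

/-- The partial derivative `∂/∂xᵢ` on `C^∞(ℝ³, V)`. -/
def partialOp (i : Fin 3) : Module.End ℂ (SmoothFun V) where
  toFun u := ⟨fun x => fderiv ℝ u.1 x (EuclideanSpace.single i 1),
    ((SmoothFun.contDiff u).fderiv_right (m := ∞) (by simp)).clm_apply contDiff_const⟩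
  map_add' u w := by
    ext x
    have hu : DifferentiableAt ℝ u.1 x := ((SmoothFun.contDiff u).differentiable (by simp)) x
    have hw : DifferentiableAt ℝ w.1 x := ((SmoothFun.contDiff w).differentiable (by simp)) x
    change fderiv ℝ (u.1 + w.1) x _ = fderiv ℝ u.1 x _ + fderiv ℝ w.1 x _
    rw [fderiv_add hu hw]
    rfl
  map_smul' c u := by
    ext x
    have hu : DifferentiableAt ℝ u.1 x := ((SmoothFun.contDiff u).differentiable (by simp)) x
    change fderiv ℝ (c • u.1) x _ = c • fderiv ℝ u.1 x _
    rw [fderiv_const_smul hu]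
    rfl

/-- Multiplication by a smooth `End(V)`-valued function `a`: `(M_a u)(x) = a(x) u(x)`. -/
def mulOp (a : E3 → V →L[ℂ] V) (ha : ContDiff ℝ ∞ a) : Module.End ℂ (SmoothFun V) where
  toFun u := ⟨fun x => a x (u.1 x), by
    have h : ContDiff ℝ ∞ fun x => (ContinuousLinearMap.restrictScalarsL ℂ V V ℝ ℝ) (a x) :=
      (ContinuousLinearMap.contDiff _).comp ha
    exact h.clm_apply (SmoothFun.contDiff u)⟩
  map_add' u w := by
    ext x
    exact map_add (a x) (u.1 x) (w.1 x)
  map_smul' c u := by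
    ext x
    exact map_smul (a x) c (u.1 x)

/-- Multiplication by a constant `A ∈ End(V)`: the operator `I ⊗ A`. -/
def constOp (A : V →L[ℂ] V) : Module.End ℂ (SmoothFun V) := mulOp (fun _ => A) contDiff_const

lemma laplacian_eq_sum_partialOp (u : SmoothFun V) :
    Laplacian.laplacian u.1 = ((∑ i, partialOp i * partialOp i : Module.End ℂ (SmoothFun V)) u).1 := by
  rw [InnerProductSpace.laplacian_eq_iteratedFDeriv_orthonormalBasis u.1
    (EuclideanSpace.basisFun (Fin 3) ℝ)]
  funext x
  have hf : DifferentiableAt ℝ (fderiv ℝ u.1) x :=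
    (((SmoothFun.contDiff u).fderiv_right (m := ∞) (by simp)).differentiable (by simp)) x
  simp only [LinearMap.sum_apply, Submodule.coe_sum, Finset.sum_apply]
  refine Finset.sum_congr rfl fun i _ => ?_
  rw [iteratedFDeriv_two_apply]
  change _ = fderiv ℝ (fun y => fderiv ℝ u.1 y (EuclideanSpace.single i 1)) x
    (EuclideanSpace.single i 1)
  rw [fderiv_clm_apply hf (differentiableAt_const _)]
  simp

/-- The operator `Δ ⊗ I`: the Laplacian on `C^∞(ℝ³, V)`. -/
def laplacianOp : Module.End ℂ (SmoothFun V) where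
  toFun u := ⟨Laplacian.laplacian u.1, by
    rw [laplacian_eq_sum_partialOp]
    exact Subtype.property _⟩
  map_add' u w := by
    apply Subtype.ext
    change Laplacian.laplacian (u + w).1 = Laplacian.laplacian u.1 + Laplacian.laplacian w.1
    simp only [laplacian_eq_sum_partialOp, map_add]
    rfl
  map_smul' c u := by
    apply Subtype.ext
    change Laplacian.laplacian (c • u).1 = c • Laplacian.laplacian u.1
    simp only [laplacian_eq_sum_partialOp, map_smul]
    rfl

/-- The operator `D_τ = ∑ᵢ ∂/∂xᵢ dτ(Yᵢ)`. -/
def Dtau [FiniteDimensional ℂ V] (τ : Representation ℂ SO3 V) : Module.End ℂ (SmoothFun V) :=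
  ∑ i, partialOp i * constOp (derivedRep τ (basisY i))

/-- Translations: `(L_y u)(x) = u(x - y)`. -/
def translateOp (y : E3) : Module.End ℂ (SmoothFun V) where
  toFun u := ⟨fun x => u.1 (x - y), (SmoothFun.contDiff u).comp (contDiff_id.sub contDiff_const)⟩
  map_add' _ _ := rfl
  map_smul' _ _ := rfl

/-- The action of `SO(3)`: `(k · u)(x) = τ(k) u(k⁻¹ x)`. -/
def rotateOp [FiniteDimensional ℂ V] (τ : Representation ℂ SO3 V) (k : SO3) : Module.End ℂ (SmoothFun V) where
  toFun u := ⟨fun x => τ k (u.1 (rotate k⁻¹ x)), by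
    have h : ContDiff ℝ ∞ fun x => u.1 (rotate k⁻¹ x) :=
      (SmoothFun.contDiff u).comp (ContinuousLinearMap.contDiff _)
    exact (ContinuousLinearMap.contDiff ((opOf τ k).restrictScalars ℝ)).comp h⟩
  map_add' u w := by
    ext x
    exact map_add (τ k) _ _
  map_smul' c u := by
    ext x
    exact map_smul (τ k) c _

/-! ### Differential operators -/

variable (V) in
/-- The algebra of all linear differential operators on `C^∞(ℝ³, V)` with smooth coefficients:
the finite sums `∑_α a_α(x) ∂^α` with smooth `a_α : ℝ³ → End(V)`, that is, the algebra
generated by the partial derivatives and the multiplications by smooth `End(V)`-valued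
functions. -/
def diffOps : Subalgebra ℂ (Module.End ℂ (SmoothFun V)) :=
  Algebra.adjoin ℂ
    (Set.range (partialOp (V := V)) ∪ {D | ∃ a, ∃ ha : ContDiff ℝ ∞ a, D = mulOp a ha})

/-- The algebra `(𝔻(ℝ³) ⊗ End(V))^{SO(3)}` of those differential operators on `V`-valued
functions on `ℝ³` that commute with all translations and with the action of `SO(3)`. -/
def invariantDiffOps [FiniteDimensional ℂ V] (τ : Representation ℂ SO3 V) : Subalgebra ℂ (Module.End ℂ (SmoothFun V)) :=
  diffOps V ⊓ Subalgebra.centralizer ℂ (Set.range (translateOp (V := V)) ∪ Set.range (rotateOp τ))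

end EuclideanMotion

end

/-! A translation-invariant differential operator has constant coefficients, so it is M(∂) for a
polynomial map M : ℂ³ → End(V), its symbol (`exists_symbol_of_commute_translateOp`). Testing on the
functions e^{ξ·x}v turns commutation with SO(3) into equivariance, M(kξ)τ(k) = τ(k)M(ξ). Homogeneous
components of an equivariant symbol are equivariant, so M may be taken homogeneous of degree d, and
the proof is an induction on d.

The point is to restrict M to the isotropic cone q = ξ₁² + ξ₂² + ξ₃² = 0. Every isotropic vector is
a complex multiple of a real rotation of e = (1, i, 0), so on the cone M is determined by P = M(e).
Differentiate equivariance at e. The complexified element Y₁ + iY₂ kills e, so P commutes with E =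
dτ(Y₁) + i dτ(Y₂); Y₃ multiplies e by i, so by Euler's identity P has weight d: [dτ(Y₃), P] = id P.
Since τ is irreducible, the vectors Eⁿv span V for a lowest weight vector v. Hence P is determined
by Pv, which is a weight vector d steps above v, hence a multiple of E^d v, and P = cE^d
(`eq_smul_raisingOp_pow`).

But E is the value at e of the symbol of D_τ. So M minus c times the d-th power of that symbol
vanishes on the cone, its entries are divisible by q (`normSqPoly_dvd_of_eval_eq_zero`), and the
quotient is an equivariant symbol of degree d − 2. As q is the symbol of Δ, the induction closes.
The reverse inclusion is the equivariance of the two symbols.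

The Lie theory behind dτ is obtained directly: continuous one-parameter groups of operators are
exponentials, additivity of dτ comes from the Lie product formula, and a subspace stable under the
dτ(Yᵢ) is τ-invariant because the one-parameter groups of the Yᵢ generate SO(3). -/

noncomputable section

namespace EuclideanMotion

/-! ### One-parameter groups and the Lie product formula in a Banach algebra -/

section BanachAlgebra

open Filter Topology NormedSpace

variable {B : Type*} [NormedRing B] [NormedAlgebra ℝ B] [CompleteSpace B]

/-- A norm-continuous one-parameter semigroup is differentiable at `0`. -/
lemma exists_hasDerivAt_zero_of_continuous_oneParam (φ : ℝ → B) (hc : Continuous φ)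
    (h0 : φ 0 = 1) (hadd : ∀ s t, φ (s + t) = φ s * φ t) : ∃ A, HasDerivAt φ A 0 := by
  set Φ : ℝ → B := fun x => ∫ s in (0 : ℝ)..x, φ s with hΦ
  have hΦd : ∀ x, HasDerivAt Φ (φ x) x := fun x =>
    intervalIntegral.integral_hasDerivAt_right (hc.intervalIntegrable _ _)
      (hc.stronglyMeasurableAtFilter _ _) hc.continuousAt
  have hslope := (hΦd 0).tendsto_slope_zero
  rw [h0] at hslope
  -- The averages of φ over [0, t] tend to φ 0 = 1 and the units are open, so some average is
  -- invertible.
  have hunit : ∀ᶠ t in 𝓝[≠] (0 : ℝ), IsUnit (t⁻¹ • (Φ (0 + t) - Φ 0)) :=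
    hslope.eventually (Units.isOpen.mem_nhds isUnit_one)
  obtain ⟨a, ha, ha0⟩ := (hunit.and self_mem_nhdsWithin).exists
  have ha0' : a ≠ 0 := ha0
  have hΦ0 : Φ 0 = 0 := by simp [hΦ]
  rw [zero_add, hΦ0, sub_zero] at ha
  obtain ⟨u, hu⟩ := ha
  -- The integral of φ over [t, t + a] is φ t * Φ a. As Φ a is invertible, φ is expressed through
  -- its differentiable primitive Φ.
  have hkey : ∀ t, φ t = (Φ (t + a) - Φ t) * (a⁻¹ • (↑u⁻¹ : B)) := by
    intro t
    have h1 : φ t * Φ a = Φ (t + a) - Φ t := by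
      have h2 : ∫ s in (0 : ℝ)..a, φ (t + s) = φ t * Φ a := by
        simp only [hadd]
        exact (ContinuousLinearMap.intervalIntegral_comp_comm (ContinuousLinearMap.mul ℝ B (φ t))
          (hc.intervalIntegrable _ _))
      rw [← h2, intervalIntegral.integral_comp_add_left, add_zero, hΦ]
      exact (intervalIntegral.integral_interval_sub_left (hc.intervalIntegrable _ _)
        (hc.intervalIntegrable _ _)).symm
    rw [← h1, mul_smul_comm, mul_assoc, ← mul_smul_comm, ← smul_mul_assoc, ← hu, Units.mul_inv,
      mul_one]
  refine ⟨(φ (0 + a) - φ 0) * (a⁻¹ • (↑u⁻¹ : B)), ?_⟩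
  exact ((((hΦd (0 + a)).comp_add_const 0 a).sub (hΦd 0)).mul_const _).congr_of_eventuallyEq
    (Eventually.of_forall hkey)

/-- A norm-continuous one-parameter semigroup is the exponential of its derivative at `0`. -/
lemma eq_exp_smul_of_hasDerivAt_zero (φ : ℝ → B) {A : B} (hA : HasDerivAt φ A 0)
    (h0 : φ 0 = 1) (hadd : ∀ s t, φ (s + t) = φ s * φ t) (t : ℝ) : φ t = exp (t • A) := by
  let _ : NormedAlgebra ℚ B := NormedAlgebra.restrictScalars ℚ ℝ B
  have hd : ∀ t, HasDerivAt φ (φ t * A) t := by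
    intro t
    have h1 : HasDerivAt (fun s => φ t * φ (s - t)) (φ t * A) t := by
      refine HasDerivAt.const_mul (φ t) ?_
      have : HasDerivAt φ A (t - t) := by rwa [sub_self]
      exact this.comp_sub_const t t
    refine h1.congr_of_eventuallyEq (Eventually.of_forall fun s => ?_)
    change φ s = φ t * φ (s - t)
    rw [← hadd, add_sub_cancel]
  have hE : ∀ t : ℝ, HasDerivAt (fun s : ℝ => exp (s • (-A))) (-A * exp (t • (-A))) t :=
    fun t => hasDerivAt_exp_smul_const' (-A) t
  have hg : ∀ t, HasDerivAt (fun s => φ s * exp (s • (-A))) 0 t := by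
    intro t
    have h := (hd t).mul (hE t)
    rwa [mul_assoc, ← mul_add, neg_mul, add_neg_cancel, mul_zero] at h
  have hconst := is_const_of_deriv_eq_zero (fun t => (hg t).differentiableAt)
    (fun t => (hg t).deriv) t 0
  simp only [zero_smul, exp_zero, h0, mul_one] at hconst
  have hinv : exp (t • (-A)) * exp (t • A) = 1 := by
    rw [← exp_add_of_commute]
    · rw [smul_neg, neg_add_cancel, exp_zero]
    · rw [smul_neg]; exact (Commute.refl _).neg_left
  calc φ t = φ t * (exp (t • (-A)) * exp (t • A)) := by rw [hinv, mul_one]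
    _ = exp (t • A) := by rw [← mul_assoc, hconst, one_mul]

lemma norm_exp_le_exp_norm {B : Type*} [NormedRing B] [NormedAlgebra ℝ B] [NormOneClass B] (x : B) :
    ‖exp x‖ ≤ Real.exp ‖x‖ := by
  rw [exp_eq_tsum ℝ, Real.exp_eq_exp_ℝ, exp_eq_tsum ℝ]
  refine tsum_of_norm_bounded (expSeries_summable' (𝕂 := ℝ) ‖x‖).hasSum fun n => ?_
  rw [norm_smul, norm_inv, RCLike.norm_natCast, smul_eq_mul]
  gcongr
  exact norm_pow_le x n

/-- Telescoping, with one factor exchanged at a time. The exponent is n + 1 so that K appears with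
exponent n and no natural subtraction. -/
lemma norm_pow_sub_pow_le {B : Type*} [NormedRing B] [NormOneClass B] {a b : B} {K : ℝ}
    (ha : ‖a‖ ≤ K) (hb : ‖b‖ ≤ K) (n : ℕ) : ‖a ^ (n + 1) - b ^ (n + 1)‖ ≤ (n + 1) * ‖a - b‖ * K ^ n := by
  have hK : 0 ≤ K := (norm_nonneg _).trans ha
  induction n with
  | zero => simp
  | succ n ih =>
    have h : a ^ (n + 1 + 1) - b ^ (n + 1 + 1)
        = a ^ (n + 1) * (a - b) + (a ^ (n + 1) - b ^ (n + 1)) * b := by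
      rw [pow_succ a (n + 1), pow_succ b (n + 1)]; noncomm_ring
    rw [h]
    calc ‖a ^ (n + 1) * (a - b) + (a ^ (n + 1) - b ^ (n + 1)) * b‖
        ≤ ‖a ^ (n + 1)‖ * ‖a - b‖ + ‖a ^ (n + 1) - b ^ (n + 1)‖ * ‖b‖ :=
          (norm_add_le _ _).trans (add_le_add (norm_mul_le _ _) (norm_mul_le _ _))
      _ ≤ K ^ (n + 1) * ‖a - b‖ + ((n + 1) * ‖a - b‖ * K ^ n) * K := by
          gcongr
          exact (norm_pow_le a _).trans (by gcongr)
      _ = _ := by push_cast; ring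

/-- The Lie product formula. -/
lemma tendsto_exp_smul_mul_exp_smul_pow [NormOneClass B] (X Y : B) :
    Tendsto (fun n : ℕ => (exp ((n + 1 : ℝ)⁻¹ • X) * exp ((n + 1 : ℝ)⁻¹ • Y)) ^ (n + 1)) atTop
      (𝓝 (exp (X + Y))) := by
  let _ : NormedAlgebra ℚ B := NormedAlgebra.restrictScalars ℚ ℝ B
  -- The one-step error h vanishes to first order at 0. In the (n + 1)-st power it is amplified by
  -- at most n + 1 up to a bounded factor, and (n + 1)‖h(1/(n + 1))‖ is the norm of a difference
  -- quotient of h, hence tends to 0.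
  set h : ℝ → B := fun t => exp (t • X) * exp (t • Y) - exp (t • (X + Y)) with hh
  have hd : HasDerivAt h 0 0 := by
    have h1 := ((hasDerivAt_exp_smul_const' X (0 : ℝ)).mul
      (hasDerivAt_exp_smul_const' Y (0 : ℝ))).sub (hasDerivAt_exp_smul_const' (X + Y) (0 : ℝ))
    rwa [zero_smul, zero_smul, zero_smul, exp_zero, mul_one, mul_one, mul_one, mul_one, one_mul,
      sub_self] at h1
  have hslope := hd.tendsto_slope_zero
  have hn : Tendsto (fun n : ℕ => (n + 1 : ℝ)⁻¹) atTop (𝓝[≠] 0) := by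
    refine tendsto_nhdsWithin_iff.2 ⟨?_, Eventually.of_forall fun n => ?_⟩
    · simpa using tendsto_one_div_add_atTop_nhds_zero_nat (𝕜 := ℝ)
    · exact (inv_pos.2 (by positivity)).ne'
  have hlim := (hslope.comp hn).norm.mul_const (Real.exp (‖X‖ + ‖Y‖))
  rw [norm_zero, zero_mul] at hlim
  rw [tendsto_iff_norm_sub_tendsto_zero]
  refine squeeze_zero (fun _ => norm_nonneg _) (fun n => ?_) hlim
  set r : ℝ := (n + 1 : ℝ)⁻¹ with hr
  have hrpos : 0 < r := inv_pos.2 (by positivity)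
  have hnr : (n + 1 : ℝ) * r = 1 := mul_inv_cancel₀ (by positivity)
  have hb : exp (X + Y) = exp (r • (X + Y)) ^ (n + 1) := by
    rw [← exp_nsmul, ← Nat.cast_smul_eq_nsmul ℝ, smul_smul]
    push_cast
    rw [hnr, one_smul]
  have hbound : ∀ Z : B, ‖exp (r • Z)‖ ≤ Real.exp (r * ‖Z‖) := fun Z => by
    refine (norm_exp_le_exp_norm _).trans_eq ?_
    rw [norm_smul, Real.norm_of_nonneg hrpos.le]
  set K := Real.exp (r * (‖X‖ + ‖Y‖)) with hK
  have hK1 : ‖exp (r • X) * exp (r • Y)‖ ≤ K := by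
    refine (norm_mul_le _ _).trans ?_
    rw [hK, mul_add, Real.exp_add]
    exact mul_le_mul (hbound X) (hbound Y) (norm_nonneg _) (Real.exp_pos _).le
  have hK2 : ‖exp (r • (X + Y))‖ ≤ K := by
    refine (hbound _).trans ?_
    rw [hK]
    gcongr
    exact norm_add_le X Y
  have hKn : K ^ n ≤ Real.exp (‖X‖ + ‖Y‖) := by
    rw [hK, ← Real.exp_nat_mul]
    gcongr
    have : (n : ℝ) * r ≤ 1 := by nlinarith
    calc (n : ℝ) * (r * (‖X‖ + ‖Y‖)) = (n * r) * (‖X‖ + ‖Y‖) := by ring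
      _ ≤ 1 * (‖X‖ + ‖Y‖) := by gcongr
      _ = _ := one_mul _
  rw [hb]
  refine (norm_pow_sub_pow_le hK1 hK2 n).trans ?_
  have h0 : h 0 = 0 := by simp [hh]
  have hval : ‖((fun t : ℝ => t⁻¹ • (h (0 + t) - h 0)) ∘ fun n : ℕ => (n + 1 : ℝ)⁻¹) n‖
      = (n + 1) * ‖exp (r • X) * exp (r • Y) - exp (r • (X + Y))‖ := by
    simp only [Function.comp, h0, zero_add, sub_zero, inv_inv]
    rw [norm_smul, Real.norm_of_nonneg (by positivity)]
  rw [hval]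
  gcongr

end BanachAlgebra

/-! ### The exponential map and the adjoint action of SO(3) -/

section RotationGroup

open Filter Topology NormedSpace

attribute [local instance] Matrix.linftyOpNormedRing Matrix.linftyOpNormedAlgebra
  Matrix.linfty_opNormOneClass

lemma hasDerivAt_matrix_exp_smul (Y : Matrix (Fin 3) (Fin 3) ℝ) (t : ℝ) :
    HasDerivAt (fun t : ℝ => exp (t • Y)) (Y * exp (t • Y)) t :=
  hasDerivAt_exp_smul_const' Y t

lemma continuous_expSO3_smul (Y : so3) : Continuous fun t : ℝ => expSO3 (t • Y) :=
  Continuous.subtype_mk (continuous_iff_continuousAt.2 fun t =>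
    (hasDerivAt_matrix_exp_smul Y.1 t).continuousAt) _

lemma expSO3_zero : expSO3 0 = 1 := Subtype.ext exp_zero

lemma expSO3_add_smul (Y : so3) (s t : ℝ) :
    expSO3 ((s + t) • Y) = expSO3 (s • Y) * expSO3 (t • Y) := by
  refine Subtype.ext ?_
  change exp ((s + t) • Y.1) = exp (s • Y.1) * exp (t • Y.1)
  rw [add_smul, Matrix.exp_add_of_commute]
  exact ((Commute.refl _).smul_left _).smul_right _

lemma tendsto_expSO3_mul_pow (X Y : so3) :
    Tendsto (fun n : ℕ => (expSO3 ((n + 1 : ℝ)⁻¹ • X) * expSO3 ((n + 1 : ℝ)⁻¹ • Y)) ^ (n + 1))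
      atTop (𝓝 (expSO3 (X + Y))) := by
  rw [tendsto_subtype_rng]
  exact tendsto_exp_smul_mul_exp_smul_pow X.1 Y.1

lemma mul_transpose_self (k : SO3) : k.1 * k.1.transpose = 1 :=
  (Matrix.mem_orthogonalGroup_iff _ _).1 (Matrix.mem_specialOrthogonalGroup_iff.1 k.2).1

lemma transpose_mul_self (k : SO3) : k.1.transpose * k.1 = 1 :=
  (Matrix.mem_orthogonalGroup_iff' _ _).1 (Matrix.mem_specialOrthogonalGroup_iff.1 k.2).1

lemma transpose_eq_adjugate (k : SO3) : k.1.transpose = k.1.adjugate := by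
  have h1 : k.1 * k.1.adjugate = 1 := by
    rw [Matrix.mul_adjugate, (Matrix.mem_specialOrthogonalGroup_iff.1 k.2).2, one_smul]
  calc k.1.transpose = k.1.transpose * (k.1 * k.1.adjugate) := by rw [h1, mul_one]
    _ = k.1.adjugate := by rw [← mul_assoc, transpose_mul_self, one_mul]

/-- The adjoint action of `SO(3)` on the canonical basis of `so(3)`. -/
lemma conj_basisMatrix (k : SO3) (l : Fin 3) :
    k.1 * basisMatrix l * k.1.transpose = ∑ j, k.1 j l • basisMatrix j := by
  -- Each entry of k is its own cofactor. The entries of k Yₗ kᵀ are 2 × 2 minors of k, so these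
  -- nine equations give the claim linearly; it is the invariance of the cross product.
  have hadj : ∀ a b, k.1 b a = k.1.adjugate a b := fun a b => by
    rw [← transpose_eq_adjugate]; rfl
  simp only [Matrix.adjugate_fin_three] at hadj
  have h00 := hadj 0 0
  have h01 := hadj 0 1
  have h02 := hadj 0 2
  have h10 := hadj 1 0
  have h11 := hadj 1 1
  have h12 := hadj 1 2
  have h20 := hadj 2 0
  have h21 := hadj 2 1
  have h22 := hadj 2 2
  simp at h00 h01 h02 h10 h11 h12 h20 h21 h22
  ext a b
  fin_cases l <;> fin_cases a <;> fin_cases b <;>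
    simp [Matrix.mul_apply, Fin.sum_univ_three, basisMatrix, Matrix.smul_apply, Matrix.sum_apply]
      <;> linarith

lemma expSO3_conj (k : SO3) (X Y : so3) (h : k.1 * X.1 * k.1.transpose = Y.1) (t : ℝ) :
    expSO3 (t • Y) = k * expSO3 (t • X) * k⁻¹ := by
  refine Subtype.ext ?_
  change exp (t • Y.1) = k.1 * exp (t • X.1) * k.1.transpose
  have hu : IsUnit k.1 := ⟨⟨k.1, k.1.transpose, mul_transpose_self k, transpose_mul_self k⟩, rfl⟩
  have hinv : k.1⁻¹ = k.1.transpose := Matrix.inv_eq_right_inv (mul_transpose_self k)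
  rw [← hinv, ← Matrix.exp_conj _ _ hu, hinv, ← h, Matrix.mul_smul, Matrix.smul_mul]

end RotationGroup

/-! ### The derived representation: linearity, equivariance, commutators -/

section DerivedRepresentation

open Filter Topology NormedSpace

variable {V : Type*} [NormedAddCommGroup V] [InnerProductSpace ℂ V] [FiniteDimensional ℂ V]
  {τ : Representation ℂ SO3 V}

lemma opOf_apply (k : SO3) (v : V) : opOf τ k v = τ k v := rfl

lemma opOf_one : opOf τ 1 = 1 := by ext v; simp [opOf_apply]

lemma opOf_mul (k l : SO3) : opOf τ (k * l) = opOf τ k * opOf τ l := by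
  ext v; simp [opOf_apply]

lemma opOf_pow (k : SO3) (n : ℕ) : opOf τ (k ^ n) = opOf τ k ^ n := by
  ext v
  induction n generalizing v with
  | zero => simp [opOf_one]
  | succ n ih => rw [pow_succ, pow_succ, opOf_mul, mul_apply_eq_comp, ih]; rfl

lemma opOf_mul_inv (k : SO3) : opOf τ k * opOf τ k⁻¹ = 1 := by
  rw [← opOf_mul, mul_inv_cancel, opOf_one]

lemma opOf_inv_mul (k : SO3) : opOf τ k⁻¹ * opOf τ k = 1 := by
  rw [← opOf_mul, inv_mul_cancel, opOf_one]

lemma continuous_opOf (hc : ∀ v : V, Continuous fun k : SO3 => τ k v) : Continuous (opOf τ) :=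
  continuous_clm_apply.2 hc

variable (hc : ∀ v : V, Continuous fun k : SO3 => τ k v)
include hc

/-- Ensures that `derivedRep` is a genuine derivative and not the default value of `deriv`. In
finite dimension strong continuity is norm continuity, so the one-parameter group is differentiable.
-/
lemma hasDerivAt_opOf_expSO3 (Y : so3) :
    HasDerivAt (fun t : ℝ => opOf τ (expSO3 (t • Y))) (derivedRep τ Y) 0 := by
  have : CompleteSpace V := FiniteDimensional.complete ℂ V
  obtain ⟨A, hA⟩ := exists_hasDerivAt_zero_of_continuous_oneParam
    (fun t : ℝ => opOf τ (expSO3 (t • Y))) ((continuous_opOf hc).comp (continuous_expSO3_smul Y))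
    (by simp only [zero_smul, expSO3_zero, opOf_one])
    (fun s t => by simp only [expSO3_add_smul, opOf_mul])
  exact hA.differentiableAt.hasDerivAt

lemma opOf_expSO3_smul (Y : so3) (t : ℝ) :
    opOf τ (expSO3 (t • Y)) = exp (t • derivedRep τ Y) := by
  have : CompleteSpace V := FiniteDimensional.complete ℂ V
  exact eq_exp_smul_of_hasDerivAt_zero (fun t : ℝ => opOf τ (expSO3 (t • Y)))
    (hasDerivAt_opOf_expSO3 hc Y)
    (by simp only [zero_smul, expSO3_zero, opOf_one])
    (fun s t => by simp only [expSO3_add_smul, opOf_mul]) t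

lemma derivedRep_smul (c : ℝ) (Y : so3) : derivedRep τ (c • Y) = c • derivedRep τ Y := by
  have h := hasDerivAt_opOf_expSO3 hc Y
  rw [← zero_mul c] at h
  have h2 := h.scomp_of_eq (0 : ℝ) ((hasDerivAt_id (0 : ℝ)).mul_const c) (by simp)
  rw [one_mul] at h2
  refine HasDerivAt.unique (hasDerivAt_opOf_expSO3 hc (c • Y)) (h2.congr_of_eventuallyEq ?_)
  exact Eventually.of_forall fun t => by simp [Function.comp, smul_smul]

/-- Apply τ to the Lie product formula in SO(3) and compare with the same formula in End(V); limits
are unique. `Nontrivial V` provides ‖1‖ = 1. -/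
lemma derivedRep_add [Nontrivial V] (X Y : so3) :
    derivedRep τ (X + Y) = derivedRep τ X + derivedRep τ Y := by
  have : CompleteSpace V := FiniteDimensional.complete ℂ V
  have hexp : ∀ X Y : so3, opOf τ (expSO3 (X + Y)) = exp (derivedRep τ X + derivedRep τ Y) := by
    intro X Y
    have h1 := ((continuous_opOf hc).tendsto _).comp (tendsto_expSO3_mul_pow X Y)
    refine tendsto_nhds_unique h1 ?_
    refine (tendsto_exp_smul_mul_exp_smul_pow (derivedRep τ X) (derivedRep τ Y)).congr fun n => ?_
    simp only [Function.comp, opOf_pow, opOf_mul, opOf_expSO3_smul hc]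
  refine HasDerivAt.unique (hasDerivAt_opOf_expSO3 hc (X + Y)) ?_
  have h2 := hasDerivAt_exp_smul_const' (derivedRep τ X + derivedRep τ Y) (0 : ℝ)
  rw [zero_smul, exp_zero, mul_one] at h2
  refine h2.congr_of_eventuallyEq (Eventually.of_forall fun t => ?_)
  simp only
  rw [smul_add, hexp, derivedRep_smul hc, derivedRep_smul hc, smul_add]

lemma derivedRep_conj (k : SO3) (X Y : so3) (h : k.1 * X.1 * k.1.transpose = Y.1) :
    opOf τ k * derivedRep τ X * opOf τ k⁻¹ = derivedRep τ Y := by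
  refine HasDerivAt.unique ?_ (hasDerivAt_opOf_expSO3 hc Y)
  simp only [expSO3_conj k X Y h, opOf_mul]
  exact ((hasDerivAt_opOf_expSO3 hc X).const_mul _).mul_const _

/-- The adjoint action on the operators `dτ(Yₗ)`. -/
lemma opOf_mul_derivedRep_basisY [Nontrivial V] (k : SO3) (l : Fin 3) :
    opOf τ k * derivedRep τ (basisY l) * opOf τ k⁻¹ =
      ∑ j, k.1 j l • derivedRep τ (basisY j) := by
  rw [derivedRep_conj hc k (basisY l) (∑ j, k.1 j l • basisY j)]
  · simp only [Fin.sum_univ_three, derivedRep_add hc, derivedRep_smul hc]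
  · rw [show (basisY l).1 = basisMatrix l from rfl, conj_basisMatrix]
    simp only [Fin.sum_univ_three]
    rfl

/-- The commutation relations of the operators `dτ(Yᵢ)`. -/
lemma derivedRep_basisY_commutator [Nontrivial V] (i j : Fin 3) :
    derivedRep τ (basisY i) * derivedRep τ (basisY j)
      - derivedRep τ (basisY j) * derivedRep τ (basisY i) =
      ∑ l, basisMatrix i l j • derivedRep τ (basisY l) := by
  have hE := hasDerivAt_opOf_expSO3 hc (basisY i)
  have hleft := (hE.mul_const (derivedRep τ (basisY j)))
  have hright : HasDerivAt
      (fun t : ℝ => ∑ l, (expSO3 (t • basisY i)).1 l j • derivedRep τ (basisY l))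
      (∑ l, basisMatrix i l j • derivedRep τ (basisY l)) 0 := by
    refine HasDerivAt.fun_sum fun l _ => ?_
    have h := hasDerivAt_matrix_exp_smul (basisMatrix i) 0
    rw [zero_smul, exp_zero, mul_one] at h
    have h' : HasDerivAt (fun t : ℝ => (expSO3 (t • basisY i)).1 l j) (basisMatrix i l j) 0 :=
      hasDerivAt_pi.1 (hasDerivAt_pi.1 h l) j
    exact h'.smul_const (derivedRep τ (basisY l))
  have hright2 := hright.mul hE
  -- This identity is differentiated at t = 0 on both sides; the trailing factor τ(exp tYᵢ)
  -- contributes the second half of the commutator.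
  have heq : ∀ t : ℝ, opOf τ (expSO3 (t • basisY i)) * derivedRep τ (basisY j) =
      (∑ l, (expSO3 (t • basisY i)).1 l j • derivedRep τ (basisY l))
        * opOf τ (expSO3 (t • basisY i)) := fun t => by
    rw [← opOf_mul_derivedRep_basisY hc, mul_assoc, opOf_inv_mul, mul_one]
  have h := hleft.unique (hright2.congr_of_eventuallyEq (Eventually.of_forall heq))
  have hz : (expSO3 ((0 : ℝ) • basisY i)) = 1 := by rw [zero_smul, expSO3_zero]
  have hsum : ∑ l, (1 : SO3).1 l j • derivedRep τ (basisY l) = derivedRep τ (basisY j) := by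
    simp [Matrix.one_apply]
  rw [hz, opOf_one, mul_one, hsum] at h
  rw [h, add_sub_cancel_right]

end DerivedRepresentation

/-! ### Lowest weight vectors and operators commuting with the raising operator -/

section LadderOperators

variable {V : Type*} [AddCommGroup V] [Module ℂ V]

/-- If `F` lowers the eigenvalues of `H` by one, some eigenvector of `H` is killed by `F`. -/
lemma exists_lowest_weight_vector [FiniteDimensional ℂ V] [Nontrivial V] (H F : Module.End ℂ V)
    (hHF : H * F - F * H = -F) : ∃ (μ : ℂ) (v : V), v ≠ 0 ∧ H v = μ • v ∧ F v = 0 := by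
  obtain ⟨μ₀, hμ₀⟩ := Module.End.exists_eigenvalue H
  -- Take an eigenvalue of least real part: if F v were nonzero it would be an eigenvector for μ −
  -- 1.
  obtain ⟨μ, hμ, hmin⟩ := Set.exists_min_image {μ | H.HasEigenvalue μ} Complex.re
    (Module.End.finite_hasEigenvalue H) ⟨μ₀, hμ₀⟩
  obtain ⟨v, hv⟩ := Module.End.HasEigenvalue.exists_hasEigenvector hμ
  refine ⟨μ, v, hv.2, hv.apply_eq_smul, ?_⟩
  by_contra hF
  have h1 : H (F v) = (μ - 1) • F v := by
    have h := LinearMap.congr_fun hHF v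
    simp only [LinearMap.sub_apply, Module.End.mul_apply, LinearMap.neg_apply, hv.apply_eq_smul,
      map_smul] at h
    rw [sub_eq_iff_eq_add.1 h]
    module
  have h2 := hmin (μ - 1) (Module.End.hasEigenvalue_of_hasEigenvector
    (Module.End.hasEigenvector_iff.2 ⟨Module.End.mem_eigenspace_iff.2 h1, hF⟩))
  simp at h2
  linarith

lemma apply_pow_raising {H E : Module.End ℂ V} (hHE : H * E - E * H = E) {μ : ℂ} {v : V}
    (hv : H v = μ • v) (n : ℕ) : H ((E ^ n) v) = (μ + n) • (E ^ n) v := by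
  induction n with
  | zero => simpa using hv
  | succ n ih =>
    have h := LinearMap.congr_fun hHE ((E ^ n) v)
    simp only [LinearMap.sub_apply, Module.End.mul_apply, ih, map_smul] at h
    rw [pow_succ', Module.End.mul_apply, sub_eq_iff_eq_add.1 h]
    push_cast
    module

/-- The span of the `Eⁿ v`, for a lowest weight vector `v`, is stable under `E`, `H` and `F`. -/
lemma span_pow_raising_stable {H E F : Module.End ℂ V} (hHE : H * E - E * H = E) {c : ℂ}
    (hEF : E * F - F * E = c • H) {μ : ℂ} {v : V} (hv : H v = μ • v) (hF : F v = 0) :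
    ∀ T ∈ ({E, H, F} : Set (Module.End ℂ V)),
      ∀ w ∈ Submodule.span ℂ (Set.range fun n : ℕ => (E ^ n) v),
        T w ∈ Submodule.span ℂ (Set.range fun n : ℕ => (E ^ n) v) := by
  set W := Submodule.span ℂ (Set.range fun n : ℕ => (E ^ n) v)
  have hmem : ∀ n : ℕ, (E ^ n) v ∈ W := fun n => Submodule.subset_span ⟨n, rfl⟩
  have key : ∀ T : Module.End ℂ V, (∀ n : ℕ, T ((E ^ n) v) ∈ W) → ∀ w ∈ W, T w ∈ W := by
    intro T hT w hw
    have : W ≤ W.comap T := Submodule.span_le.2 (by rintro _ ⟨n, rfl⟩; exact hT n)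
    exact this hw
  have hE : ∀ w ∈ W, E w ∈ W := key E fun n => by
    rw [← Module.End.mul_apply, ← pow_succ']; exact hmem _
  have hH : ∀ n : ℕ, H ((E ^ n) v) ∈ W := fun n => by
    rw [apply_pow_raising hHE hv]; exact W.smul_mem _ (hmem n)
  rintro T (rfl | rfl | rfl)
  · exact hE
  · exact key _ hH
  · refine key _ fun n => ?_
    induction n with
    | zero => simp [hF]
    | succ n ih =>
      -- F Eⁿ⁺¹v = E F Eⁿv − c H Eⁿv, and both terms lie in W by induction.
      have h := LinearMap.congr_fun hEF ((E ^ n) v)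
      simp only [LinearMap.sub_apply, Module.End.mul_apply, LinearMap.smul_apply] at h
      rw [pow_succ', Module.End.mul_apply, ← sub_sub_cancel (E (T ((E ^ n) v))) (T _), h]
      exact W.sub_mem (hE _ ih) (W.smul_mem _ (hH n))

/-- If the `Eⁿ v` span, for an eigenvector `v` of `H`, then the operators that commute with `E` and
have weight `d` are the multiples of `E ^ d`. -/
lemma eq_smul_pow_of_commute {H E P : Module.End ℂ V} (hHE : H * E - E * H = E) {μ : ℂ} {v : V}
    (hv : H v = μ • v) (hspan : Submodule.span ℂ (Set.range fun n : ℕ => (E ^ n) v) = ⊤)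
    (hPE : Commute P E) {d : ℕ} (hP : H * P - P * H = (d : ℂ) • P) : ∃ c : ℂ, P = c • E ^ d := by
  have hPv : H (P v) = (μ + d) • P v := by
    have h := LinearMap.congr_fun hP v
    simp only [LinearMap.sub_apply, Module.End.mul_apply, LinearMap.smul_apply, hv, map_smul] at h
    rw [sub_eq_iff_eq_add.1 h]
    module
  -- Modulo the other eigenspaces of H, every vector is a multiple of E^d v, because the spanning
  -- vectors Eⁿv have the distinct eigenvalues μ + n. For P v, of eigenvalue μ + d, independence of
  -- the eigenspaces makes this an equality.
  have hdecomp : ∀ x : V, ∃ c : ℂ, x - c • (E ^ d) v ∈ ⨆ ν ≠ μ + d, H.eigenspace ν := by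
    intro x
    have hx : x ∈ Submodule.span ℂ (Set.range fun n : ℕ => (E ^ n) v) := hspan ▸ Submodule.mem_top
    induction hx using Submodule.span_induction with
    | mem x hx =>
      obtain ⟨n, rfl⟩ := hx
      by_cases hn : n = d
      · exact ⟨1, by simp [hn]⟩
      · refine ⟨0, ?_⟩
        rw [zero_smul, sub_zero]
        have hne : μ + (n : ℂ) ≠ μ + d := fun h => hn (by exact_mod_cast add_left_cancel h)
        exact Submodule.mem_iSup_of_mem _ (Submodule.mem_iSup_of_mem hne
          (Module.End.mem_eigenspace_iff.2 (apply_pow_raising hHE hv n)))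
    | zero => exact ⟨0, by simp⟩
    | add x y _ _ hx hy =>
      obtain ⟨a, ha⟩ := hx
      obtain ⟨b, hb⟩ := hy
      refine ⟨a + b, ?_⟩
      rw [add_smul, add_sub_add_comm]
      exact Submodule.add_mem _ ha hb
    | smul a x _ hx =>
      obtain ⟨b, hb⟩ := hx
      refine ⟨a * b, ?_⟩
      rw [mul_smul, ← smul_sub]
      exact Submodule.smul_mem _ _ hb
  obtain ⟨c, hc⟩ := hdecomp (P v)
  have hmem : P v - c • (E ^ d) v ∈ H.eigenspace (μ + d) :=
    Submodule.sub_mem _ (Module.End.mem_eigenspace_iff.2 hPv)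
      (Submodule.smul_mem _ _ (Module.End.mem_eigenspace_iff.2 (apply_pow_raising hHE hv d)))
  have hzero := (Submodule.disjoint_def.1 (Module.End.eigenspaces_iSupIndep H (μ + d))) _ hmem hc
  refine ⟨c, LinearMap.ext_on_range hspan fun n => ?_⟩
  calc P ((E ^ n) v) = (E ^ n) (P v) := LinearMap.congr_fun (hPE.pow_right n).eq v
    _ = (E ^ n) (c • (E ^ d) v) := by rw [sub_eq_zero.1 hzero]
    _ = c • (E ^ d) ((E ^ n) v) := by
      rw [map_smul, ← Module.End.mul_apply, ← Module.End.mul_apply, ← pow_add, ← pow_add, add_comm]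

end LadderOperators

/-! ### Generation of SO(3) by rotations about the coordinate axes -/

section Generation

open NormedSpace

attribute [local instance] Matrix.linftyOpNormedRing Matrix.linftyOpNormedAlgebra

lemma exp_smul_basisMatrix_two (t : ℝ) : exp (t • basisMatrix 2) =
    !![Real.cos t, Real.sin t, 0; -Real.sin t, Real.cos t, 0; 0, 0, 1] := by
  symm
  refine eq_exp_smul_of_hasDerivAt_zero
    (fun t => !![Real.cos t, Real.sin t, 0; -Real.sin t, Real.cos t, 0; 0, 0, 1]) ?_ ?_ ?_ t
  · have hc := Real.hasDerivAt_cos 0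
    have hs := Real.hasDerivAt_sin 0
    rw [Real.sin_zero, neg_zero] at hc
    rw [Real.cos_zero] at hs
    refine hasDerivAt_pi.2 fun a => hasDerivAt_pi.2 fun b => ?_
    fin_cases a <;> fin_cases b <;>
      simp [basisMatrix, hasDerivAt_const, hc, hs, hs.fun_neg]
  · ext a b
    fin_cases a <;> fin_cases b <;> simp
  · intro s t
    ext a b
    fin_cases a <;> fin_cases b <;>
      simp [Matrix.mul_apply, Fin.sum_univ_three, Real.cos_add, Real.sin_add] <;> ring

lemma exp_smul_basisMatrix_one (t : ℝ) : exp (t • basisMatrix 1) =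
    !![Real.cos t, 0, -Real.sin t; 0, 1, 0; Real.sin t, 0, Real.cos t] := by
  symm
  refine eq_exp_smul_of_hasDerivAt_zero
    (fun t => !![Real.cos t, 0, -Real.sin t; 0, 1, 0; Real.sin t, 0, Real.cos t]) ?_ ?_ ?_ t
  · have hc := Real.hasDerivAt_cos 0
    have hs := Real.hasDerivAt_sin 0
    rw [Real.sin_zero, neg_zero] at hc
    rw [Real.cos_zero] at hs
    refine hasDerivAt_pi.2 fun a => hasDerivAt_pi.2 fun b => ?_
    fin_cases a <;> fin_cases b <;>
      simp [basisMatrix, hasDerivAt_const, hc, hs, hs.fun_neg]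
  · ext a b
    fin_cases a <;> fin_cases b <;> simp
  · intro s t
    ext a b
    fin_cases a <;> fin_cases b <;>
      simp [Matrix.mul_apply, Fin.sum_univ_three, Real.cos_add, Real.sin_add] <;> ring

lemma exists_cos_sin_eq {a b : ℝ} (h : a ^ 2 + b ^ 2 = 1) : ∃ t, Real.cos t = a ∧ Real.sin t = b := by
  have hn : ‖(⟨a, b⟩ : ℂ)‖ = 1 := by
    rw [Complex.norm_def, Complex.normSq_mk, ← pow_two, ← pow_two, h, Real.sqrt_one]
  have h0 : (⟨a, b⟩ : ℂ) ≠ 0 := norm_ne_zero_iff.1 (by rw [hn]; exact one_ne_zero)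
  refine ⟨Complex.arg ⟨a, b⟩, ?_, ?_⟩
  · rw [Complex.cos_arg h0, hn, div_one]
  · rw [Complex.sin_arg, hn, div_one]

lemma exists_rotation_to_axis (a b : ℝ) : ∃ t, Real.cos t * a + Real.sin t * b = √(a ^ 2 + b ^ 2) ∧
    -Real.sin t * a + Real.cos t * b = 0 := by
  set r := √(a ^ 2 + b ^ 2) with hr
  have hr2 : r ^ 2 = a ^ 2 + b ^ 2 := Real.sq_sqrt (by positivity)
  by_cases h0 : r = 0
  · have ha : a = 0 := by nlinarith [sq_nonneg a, sq_nonneg b]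
    have hb : b = 0 := by nlinarith [sq_nonneg a, sq_nonneg b]
    exact ⟨0, by simp [ha, hb, h0]⟩
  · obtain ⟨t, hc, hs⟩ := exists_cos_sin_eq (a := a / r) (b := b / r) (by field_simp; exact hr2.symm)
    refine ⟨t, ?_, ?_⟩
    · rw [hc, hs]
      field_simp
      exact hr2.symm
    · rw [hc, hs]
      field_simp
      ring

/-- The one-parameter subgroups of the canonical basis of `so(3)` generate `SO(3)`. -/
lemma subgroup_eq_top_of_expSO3_mem (G : Subgroup SO3)
    (hG : ∀ i (t : ℝ), expSO3 (t • basisY i) ∈ G) : G = ⊤ := by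
  have coeZ : ∀ t : ℝ, (expSO3 (t • basisY 2)).1 = _ := exp_smul_basisMatrix_two
  have coeY : ∀ t : ℝ, (expSO3 (t • basisY 1)).1 = _ := exp_smul_basisMatrix_one
  -- A corner entry 1 forces the rest of the last row and column to vanish, so k is a rotation about
  -- the third axis.
  have hfix : ∀ k : SO3, k.1 2 2 = 1 → k ∈ G := by
    intro k hk
    have e (i j : Fin 3) := congrFun (congrFun (mul_transpose_self k) i) j
    have e' (i j : Fin 3) := congrFun (congrFun (transpose_mul_self k) i) j
    have ead (i j : Fin 3) := congrFun (congrFun (transpose_eq_adjugate k) i) j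
    have h1 := e 2 2
    have h2 := e' 2 2
    have h3 := e 0 0
    have h4 := ead 0 0
    have h5 := ead 0 1
    simp only [Matrix.adjugate_fin_three] at h4 h5
    simp [Matrix.mul_apply, Fin.sum_univ_three] at h1 h2 h3 h4 h5
    have k20 : k.1 2 0 = 0 := by nlinarith [sq_nonneg (k.1 2 0), sq_nonneg (k.1 2 1)]
    have k21 : k.1 2 1 = 0 := by nlinarith [sq_nonneg (k.1 2 0), sq_nonneg (k.1 2 1)]
    have k02 : k.1 0 2 = 0 := by nlinarith [sq_nonneg (k.1 0 2), sq_nonneg (k.1 1 2)]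
    have k12 : k.1 1 2 = 0 := by nlinarith [sq_nonneg (k.1 0 2), sq_nonneg (k.1 1 2)]
    simp only [k21, k02, k12, hk] at h3 h4 h5
    obtain ⟨t, hc, hs⟩ := exists_cos_sin_eq (a := k.1 0 0) (b := k.1 0 1) (by linarith)
    have : k = expSO3 (t • basisY 2) := by
      refine Subtype.ext ?_
      rw [coeZ]
      ext a b
      fin_cases a <;> fin_cases b <;> simp [hc, hs, k20, k21, k02, k12, hk] <;> linarith
    rw [this]
    exact hG 2 t
  refine (Subgroup.eq_top_iff' G).2 fun k => ?_
  obtain ⟨t, ht1, ht2⟩ := exists_rotation_to_axis (k.1 0 2) (k.1 1 2)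
  set r := √(k.1 0 2 ^ 2 + k.1 1 2 ^ 2) with hr
  have hr2 : r ^ 2 = k.1 0 2 ^ 2 + k.1 1 2 ^ 2 := Real.sq_sqrt (by positivity)
  have hcol := congrFun (congrFun (transpose_mul_self k) 2) 2
  simp [Matrix.mul_apply, Fin.sum_univ_three] at hcol
  obtain ⟨s, hc, hs⟩ := exists_cos_sin_eq (a := k.1 2 2) (b := r) (by linarith)
  -- The rotation by t brings the last column of k to (r, 0, k₂₂); the rotation by s, with cosine
  -- k₂₂ and sine r, then brings it to the third axis.
  have hprod : expSO3 (s • basisY 1) * (expSO3 (t • basisY 2) * k) ∈ G := by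
    refine hfix _ ?_
    change ((expSO3 (s • basisY 1)).1 * ((expSO3 (t • basisY 2)).1 * k.1)) 2 2 = 1
    rw [coeY, coeZ]
    simp only [Matrix.mul_apply, Fin.sum_univ_three]
    simp [hc, hs]
    linear_combination r * ht1 + hr2 + hcol
  exact (G.mul_mem_cancel_left (hG 2 t)).1 ((G.mul_mem_cancel_left (hG 1 s)).1 hprod)

end Generation

/-! ### Irreducibility in terms of dτ, and the powers of the raising operator -/

section Irreducibility

open NormedSpace

variable {V : Type*} [NormedAddCommGroup V] [InnerProductSpace ℂ V] [FiniteDimensional ℂ V]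
  {τ : Representation ℂ SO3 V}

/-- The partial sums of the exponential series stay in W, which is closed because it is
finite-dimensional. -/
lemma exp_apply_mem (A : V →L[ℂ] V) (W : Submodule ℂ V) (hA : ∀ w ∈ W, A w ∈ W) {w : V}
    (hw : w ∈ W) : exp A w ∈ W := by
  have : CompleteSpace V := FiniteDimensional.complete ℂ V
  have hpow : ∀ n : ℕ, (A ^ n) w ∈ W := by
    intro n
    induction n with
    | zero => exact hw
    | succ n ih => rw [pow_succ', mul_apply_eq_comp]; exact hA _ ih
  have hsum := (exp_series_hasSum_exp' (𝕂 := ℂ) A).mapL (ContinuousLinearMap.apply ℂ V w)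
  refine W.closed_of_finiteDimensional.mem_of_tendsto hsum (Filter.Eventually.of_forall fun s => ?_)
  exact W.sum_mem fun n _ => W.smul_mem _ (hpow n)

/-- For an irreducible `τ`, a nonzero subspace that is stable under the `dτ(Yᵢ)` is everything. -/
lemma eq_top_of_derivedRep_stable (hc : ∀ v : V, Continuous fun k : SO3 => τ k v)
    (hirr : τ.IsIrreducible) (W : Submodule ℂ V) (hW : W ≠ ⊥)
    (hs : ∀ i, ∀ w ∈ W, derivedRep τ (basisY i) w ∈ W) : W = ⊤ := by
  let G : Subgroup SO3 :=
    { carrier := {k | (∀ w ∈ W, τ k w ∈ W) ∧ ∀ w ∈ W, τ k⁻¹ w ∈ W}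
      mul_mem' := fun {a b} ha hb => ⟨fun w hw => by
          rw [map_mul]; exact ha.1 _ (hb.1 w hw), fun w hw => by
          rw [mul_inv_rev, map_mul]; exact hb.2 _ (ha.2 w hw)⟩
      one_mem' := by simp
      inv_mem' := fun {a} ha => ⟨ha.2, by rw [inv_inv]; exact ha.1⟩ }
  have hexp : ∀ i (t : ℝ), ∀ w ∈ W, τ (expSO3 (t • basisY i)) w ∈ W := by
    intro i t w hw
    rw [← opOf_apply, opOf_expSO3_smul hc]
    refine exp_apply_mem _ W (fun w hw => ?_) hw
    have := W.smul_mem (t : ℂ) (hs i w hw)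
    exact this
  have hG : G = ⊤ := subgroup_eq_top_of_expSO3_mem G fun i t => by
    refine ⟨hexp i t, ?_⟩
    have hinv : (expSO3 (t • basisY i))⁻¹ = expSO3 ((-t) • basisY i) := by
      rw [inv_eq_iff_mul_eq_one, ← expSO3_add_smul, add_neg_cancel, zero_smul, expSO3_zero]
    rw [hinv]
    exact hexp i (-t)
  let S : Subrepresentation τ := ⟨W, fun k v hv => by
    have : k ∈ G := hG ▸ Subgroup.mem_top k
    exact this.1 v hv⟩
  rcases hirr.eq_bot_or_eq_top S with h | h
  · exact absurd (congrArg Subrepresentation.toSubmodule h) hW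
  · exact congrArg Subrepresentation.toSubmodule h

omit [FiniteDimensional ℂ V] in
lemma nontrivial_of_isIrreducible (hirr : τ.IsIrreducible) : Nontrivial V := by
  by_contra h
  rw [not_nontrivial_iff_subsingleton] at h
  exact bot_ne_top (α := Subrepresentation τ)
    (Subrepresentation.toSubmodule_injective (Subsingleton.elim _ _))

/-- The raising operator `dτ(Y₁) + i dτ(Y₂)`. -/
def raisingOp (τ : Representation ℂ SO3 V) : V →L[ℂ] V :=
  derivedRep τ (basisY 0) + Complex.I • derivedRep τ (basisY 1)

/-- The operators of weight `d` that commute with the raising operator are the multiples of its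
`d`-th power. -/
lemma eq_smul_raisingOp_pow (hc : ∀ v : V, Continuous fun k : SO3 => τ k v)
    (hirr : τ.IsIrreducible) {P : V →L[ℂ] V} (hPE : Commute P (raisingOp τ)) {d : ℕ}
    (hP : derivedRep τ (basisY 2) * P - P * derivedRep τ (basisY 2) = (d * Complex.I) • P) :
    ∃ c : ℂ, P = c • raisingOp τ ^ d := by
  have := nontrivial_of_isIrreducible hirr
  have h01 := derivedRep_basisY_commutator hc 0 1
  have h20 := derivedRep_basisY_commutator hc 2 0
  have h21 := derivedRep_basisY_commutator hc 2 1
  simp [Fin.sum_univ_three, basisMatrix] at h01 h20 h21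
  let Ψ : (V →L[ℂ] V) ≃ₐ[ℂ] Module.End ℂ V := (Module.End.toContinuousLinearMap V).symm
  set A : Fin 3 → Module.End ℂ V := fun i => Ψ (derivedRep τ (basisY i)) with hA
  have g01 : A 0 * A 1 - A 1 * A 0 = -A 2 := by
    simp only [hA, ← map_mul, ← map_sub, ← map_neg, h01]
  have g20 : A 2 * A 0 - A 0 * A 2 = -A 1 := by
    simp only [hA, ← map_mul, ← map_sub, ← map_neg, h20]
  have g21 : A 2 * A 1 - A 1 * A 2 = A 0 := by
    simp only [hA, ← map_mul, ← map_sub, h21]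
  have hI : Complex.I * Complex.I = -1 := Complex.I_mul_I
  -- The factor −i makes the weight steps of H equal to ±1. In this normalization [H, E] = E, [H, F]
  -- = −F and [E, F] = −2H.
  set H : Module.End ℂ V := -(Complex.I • A 2) with hH
  set E : Module.End ℂ V := A 0 + Complex.I • A 1 with hE
  set F : Module.End ℂ V := A 0 - Complex.I • A 1 with hF
  have e1 : H * E - E * H = E := by
    have : H * E - E * H = -Complex.I • (A 2 * A 0 - A 0 * A 2)
        - (Complex.I * Complex.I) • (A 2 * A 1 - A 1 * A 2) := by
      simp only [hH, hE, mul_add, add_mul, neg_mul, mul_neg, smul_mul_assoc, mul_smul_comm]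
      module
    rw [this, g20, g21, hI, hE]
    module
  have e2 : H * F - F * H = -F := by
    have : H * F - F * H = -Complex.I • (A 2 * A 0 - A 0 * A 2)
        + (Complex.I * Complex.I) • (A 2 * A 1 - A 1 * A 2) := by
      simp only [hH, hF, mul_sub, sub_mul, neg_mul, mul_neg, smul_mul_assoc, mul_smul_comm]
      module
    rw [this, g20, g21, hI, hF]
    module
  have e3 : E * F - F * E = (-2 : ℂ) • H := by
    have : E * F - F * E = (-2 * Complex.I) • (A 0 * A 1 - A 1 * A 0) := by
      simp only [hE, hF, mul_sub, sub_mul, mul_add, add_mul, smul_mul_assoc, mul_smul_comm]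
      module
    rw [this, g01, hH]
    module
  obtain ⟨μ, v, hv0, hHv, hFv⟩ := exists_lowest_weight_vector H F e2
  have hstab := span_pow_raising_stable e1 e3 hHv hFv
  set W := Submodule.span ℂ (Set.range fun n : ℕ => (E ^ n) v) with hW
  have hEW := hstab E (by simp)
  have hHW := hstab H (by simp)
  have hFW := hstab F (by simp)
  have hWtop : W = ⊤ := by
    refine eq_top_of_derivedRep_stable hc hirr W ?_ fun i w hw => ?_
    · intro h
      have : v ∈ W := Submodule.subset_span ⟨0, rfl⟩
      rw [h, Submodule.mem_bot] at this
      exact hv0 this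
    · change A i w ∈ W
      have hAE : A 0 = (1 / 2 : ℂ) • (E + F) := by rw [hE, hF]; module
      have hA1 : A 1 = (-Complex.I / 2) • (E - F) := by
        rw [hE, hF]
        have : A 1 = (-(Complex.I * Complex.I)) • A 1 := by rw [hI]; simp
        nth_rw 1 [this]
        module
      have hA2 : A 2 = Complex.I • H := by
        have : A 2 = (-(Complex.I * Complex.I)) • A 2 := by rw [hI]; simp
        nth_rw 1 [this]
        rw [hH]
        module
      fin_cases i
      · change A 0 w ∈ W
        rw [hAE]
        exact W.smul_mem _ (W.add_mem (hEW w hw) (hFW w hw))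
      · change A 1 w ∈ W
        rw [hA1]
        exact W.smul_mem _ (W.sub_mem (hEW w hw) (hFW w hw))
      · change A 2 w ∈ W
        rw [hA2]
        exact W.smul_mem _ (hHW w hw)
  have hΨE : Ψ (raisingOp τ) = E := by simp [raisingOp, hE, hA]
  have hPE' : Commute (Ψ P) E := by rw [← hΨE]; exact hPE.map Ψ
  have hP' : H * Ψ P - Ψ P * H = (d : ℂ) • Ψ P := by
    have h := congrArg Ψ hP
    simp only [map_sub, map_mul, map_smul] at h
    have h2 : H * Ψ P - Ψ P * H = -Complex.I • (A 2 * Ψ P - Ψ P * A 2) := by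
      simp only [hH, neg_mul, mul_neg, smul_mul_assoc, mul_smul_comm]
      module
    rw [h2, h, smul_smul]
    congr 1
    linear_combination (-(d : ℂ)) * hI
  obtain ⟨c, hc'⟩ := eq_smul_pow_of_commute e1 hHv hWtop hPE' hP'
  refine ⟨c, Ψ.injective ?_⟩
  rw [hc', map_smul, map_pow, hΨE]

end Irreducibility

/-! ### Divisibility by the quadratic form, homogeneity, and rotation of polynomials -/

section Polynomials

open MvPolynomial

/-- The quadratic form `x₀² + x₁² + x₂²`. -/
def normSqPoly : MvPolynomial (Fin 3) ℂ := X 0 ^ 2 + X 1 ^ 2 + X 2 ^ 2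

lemma eval_normSqPoly (ξ : Fin 3 → ℂ) : eval ξ normSqPoly = ξ 0 ^ 2 + ξ 1 ^ 2 + ξ 2 ^ 2 := by
  simp [normSqPoly]

lemma normSqPoly_ne_zero : normSqPoly ≠ 0 := fun h => by
  have := congrArg (eval ![1, 0, 0]) h
  simp [eval_normSqPoly] at this

lemma isHomogeneous_normSqPoly : normSqPoly.IsHomogeneous 2 :=
  ((isHomogeneous_X_pow 0 2).add (isHomogeneous_X_pow 1 2)).add (isHomogeneous_X_pow 2 2)

/-- A polynomial that vanishes on the isotropic cone is divisible by the quadratic form. -/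
lemma normSqPoly_dvd_of_eval_eq_zero (f : MvPolynomial (Fin 3) ℂ)
    (hf : ∀ ξ : Fin 3 → ℂ, ξ 0 ^ 2 + ξ 1 ^ 2 + ξ 2 ^ 2 = 0 → eval ξ f = 0) :
    normSqPoly ∣ f := by
  -- As a polynomial in x₀ over ℂ[x₁, x₂] the quadratic form is monic, so f can be divided by it
  -- with a remainder b·x₀ + a.
  set Φ := finSuccEquiv ℂ 2
  set c : MvPolynomial (Fin 2) ℂ := X 0 ^ 2 + X 1 ^ 2
  set q : Polynomial (MvPolynomial (Fin 2) ℂ) := Polynomial.X ^ 2 + Polynomial.C c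
  have hΦq : Φ normSqPoly = q := by
    have h1 : Φ (X 1) = Polynomial.C (X 0) := finSuccEquiv_X_succ (j := (0 : Fin 2))
    have h2 : Φ (X 2) = Polynomial.C (X 1) := finSuccEquiv_X_succ (j := (1 : Fin 2))
    have h0 : Φ (X 0) = Polynomial.X := finSuccEquiv_X_zero
    simp only [normSqPoly, map_add, map_pow, h0, h1, h2, q, c, add_assoc]
  have hmonic : q.Monic := Polynomial.monic_X_pow_add_C c two_ne_zero
  have hdeg : q.natDegree = 2 := Polynomial.natDegree_X_pow_add_C
  set r := Φ f %ₘ q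
  have hr : r.natDegree ≤ 1 := by
    have := Polynomial.natDegree_modByMonic_lt (Φ f) hmonic (by
      intro h; rw [h, Polynomial.natDegree_one] at hdeg; omega)
    change (Φ f %ₘ q).natDegree ≤ 1
    omega
  obtain ⟨b, a, hba⟩ := Polynomial.exists_eq_X_add_C_of_natDegree_le_one hr
  have hdiv : r + q * (Φ f /ₘ q) = Φ f := Polynomial.modByMonic_add_div (Φ f) q
  have hval : ∀ (s : Fin 2 → ℂ) (y : ℂ), y ^ 2 + (s 0 ^ 2 + s 1 ^ 2) = 0 →
      eval s b * y + eval s a = 0 := by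
    intro s y hy
    have h := hf (Fin.cons y s) (by
      have e1 : (Fin.cons y s : Fin 3 → ℂ) 1 = s 0 := rfl
      have e2 : (Fin.cons y s : Fin 3 → ℂ) 2 = s 1 := rfl
      rw [e1, e2, Fin.cons_zero, add_assoc]; exact hy)
    rw [eval_eq_eval_mv_eval', show finSuccEquiv ℂ 2 f = Φ f from rfl, ← hdiv, hba] at h
    simpa [q, c, hy] using h
  -- Above s the form has the roots ±y, and the remainder vanishes at both: half the sum gives a(s)
  -- = 0, half the difference b(s)y = 0.
  have hcalc : ∀ s : Fin 2 → ℂ, eval s a = 0 ∧ (eval s c ≠ 0 → eval s b = 0) := by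
    intro s
    obtain ⟨y, hy⟩ := IsAlgClosed.exists_pow_nat_eq (-(s 0 ^ 2 + s 1 ^ 2)) two_pos
    have h1 := hval s y (by rw [hy]; ring)
    have h2 := hval s (-y) (by rw [neg_sq, hy]; ring)
    refine ⟨by linear_combination (h1 + h2) / 2, fun hc => ?_⟩
    have hy0 : y ≠ 0 := by
      rintro rfl
      apply hc
      simp only [c, map_add, map_pow, eval_X]
      linear_combination hy
    have h3 : eval s b * y = 0 := by linear_combination (h1 - h2) / 2
    exact (mul_eq_zero.1 h3).resolve_right hy0
  have ha : a = 0 := MvPolynomial.funext fun s => by rw [(hcalc s).1, map_zero]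
  have hb : b = 0 := by
    -- b(s) = 0 is known only where c(s) ≠ 0. The product c·b vanishes everywhere, and c is not the
    -- zero polynomial.
    have hcb : c * b = 0 := MvPolynomial.funext fun s => by
      rw [map_mul, map_zero]
      by_cases h : eval s c = 0
      · rw [h, zero_mul]
      · rw [(hcalc s).2 h, mul_zero]
    refine (mul_eq_zero.1 hcb).resolve_left fun h => ?_
    have := congrArg (eval ![1, 0]) h
    simp [c] at this
  have hdvd : q ∣ Φ f := ⟨Φ f /ₘ q, by
    rw [hba, ha, hb] at hdiv
    simpa using hdiv.symm⟩
  rw [← hΦq] at hdvd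
  exact (map_dvd_iff Φ).1 hdvd

/-- Allows the quotient of a homogeneous polynomial by the form to be chosen homogeneous, two
degrees lower. -/
lemma homogeneousComponent_normSqPoly_mul (g : MvPolynomial (Fin 3) ℂ) (d : ℕ) :
    homogeneousComponent d (normSqPoly * g) =
      if 2 ≤ d then normSqPoly * homogeneousComponent (d - 2) g else 0 := by
  conv_lhs => rw [← sum_homogeneousComponent g, Finset.mul_sum, map_sum]
  have h : ∀ i, homogeneousComponent d (normSqPoly * homogeneousComponent i g) =
      if 2 + i = d then normSqPoly * homogeneousComponent i g else 0 := fun i => by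
    rw [homogeneousComponent_of_mem ((mem_homogeneousSubmodule _ _).2
      (isHomogeneous_normSqPoly.mul (homogeneousComponent_isHomogeneous i g)))]
    simp only [eq_comm]
  simp only [h]
  split_ifs with hd
  · rw [Finset.sum_eq_single (d - 2)]
    · rw [if_pos (by omega)]
    · intro i _ hi
      rw [if_neg (by omega)]
    · intro hi
      rw [Finset.mem_range, not_lt] at hi
      rw [homogeneousComponent_eq_zero _ _ (by omega), mul_zero, ite_self]
  · exact Finset.sum_eq_zero fun i _ => if_neg (by omega)

lemma eq_zero_of_isHomogeneous_of_normSqPoly_dvd {f : MvPolynomial (Fin 3) ℂ} {d : ℕ} (hd : d < 2)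
    (hf : f.IsHomogeneous d) (h : normSqPoly ∣ f) : f = 0 := by
  obtain ⟨g, rfl⟩ := h
  rw [← homogeneousComponent_eq_self hf, homogeneousComponent_normSqPoly_mul, if_neg (by omega)]

lemma exists_isHomogeneous_of_normSqPoly_dvd {f : MvPolynomial (Fin 3) ℂ} {d : ℕ}
    (hf : f.IsHomogeneous (d + 2)) (h : normSqPoly ∣ f) :
    ∃ g : MvPolynomial (Fin 3) ℂ, g.IsHomogeneous d ∧ f = normSqPoly * g := by
  obtain ⟨g, rfl⟩ := h
  refine ⟨homogeneousComponent d g, homogeneousComponent_isHomogeneous d g, ?_⟩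
  have h := homogeneousComponent_normSqPoly_mul g (d + 2)
  rwa [homogeneousComponent_eq_self hf, if_pos (by omega), Nat.add_sub_cancel] at h

/-- The action of `SO(3)` on `ℂ³`. -/
def rotateC (k : SO3) (ξ : Fin 3 → ℂ) : Fin 3 → ℂ := fun i => ∑ j, (k.1 i j : ℂ) * ξ j

/-- The substitution `f ↦ f ∘ k` on polynomials. -/
def substRotate (k : SO3) : MvPolynomial (Fin 3) ℂ →ₐ[ℂ] MvPolynomial (Fin 3) ℂ :=
  aeval fun i => ∑ j, C (k.1 i j : ℂ) * X j

lemma eval_substRotate (k : SO3) (ξ : Fin 3 → ℂ) (f : MvPolynomial (Fin 3) ℂ) :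
    eval ξ (substRotate k f) = eval (rotateC k ξ) f := by
  have : (aeval ξ).comp (substRotate k) = aeval (rotateC k ξ) := by
    refine algHom_ext fun i => ?_
    simp [substRotate, rotateC]
  exact AlgHom.congr_fun this f

lemma sum_mul_orthogonal (k : SO3) (j l : Fin 3) : ∑ i, k.1 i j * k.1 i l = if j = l then 1 else 0 := by
  have h := congrFun (congrFun (transpose_mul_self k) j) l
  rwa [Matrix.mul_apply, Matrix.one_apply] at h

lemma substRotate_normSqPoly (k : SO3) : substRotate k normSqPoly = normSqPoly := by
  refine MvPolynomial.funext fun ξ => ?_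
  rw [eval_substRotate, eval_normSqPoly, eval_normSqPoly]
  have e : ∀ j l, ∑ i, (k.1 i j : ℂ) * (k.1 i l : ℂ) = if j = l then 1 else 0 := fun j l => by
    have h := congrArg (fun x : ℝ => (x : ℂ)) (sum_mul_orthogonal k j l)
    push_cast at h
    rw [h]
    split_ifs <;> simp
  have h00 := e 0 0
  have h11 := e 1 1
  have h22 := e 2 2
  have h01 := e 0 1
  have h02 := e 0 2
  have h12 := e 1 2
  simp [Fin.sum_univ_three] at h00 h11 h22 h01 h02 h12
  simp only [rotateC, Fin.sum_univ_three]
  linear_combination ξ 0 ^ 2 * h00 + ξ 1 ^ 2 * h11 + ξ 2 ^ 2 * h22 + 2 * ξ 0 * ξ 1 * h01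
    + 2 * ξ 0 * ξ 2 * h02 + 2 * ξ 1 * ξ 2 * h12

/-- Rotations are linear substitutions and so preserve degree. -/
lemma homogeneousComponent_substRotate (k : SO3) (d : ℕ) (f : MvPolynomial (Fin 3) ℂ) :
    homogeneousComponent d (substRotate k f) = substRotate k (homogeneousComponent d f) := by
  have hom : ∀ i, (substRotate k (homogeneousComponent i f)).IsHomogeneous i := fun i => by
    have := (homogeneousComponent_isHomogeneous i f).aeval
      (fun i => ∑ j, C (k.1 i j : ℂ) * (X j : MvPolynomial (Fin 3) ℂ))
      (n := 1) (fun i => IsHomogeneous.sum _ _ _ fun j _ => isHomogeneous_C_mul_X _ _)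
    rwa [one_mul] at this
  conv_lhs => rw [← sum_homogeneousComponent f, map_sum, map_sum]
  simp only [fun i => homogeneousComponent_of_mem (m := d)
    ((mem_homogeneousSubmodule i _).2 (hom i))]
  rw [Finset.sum_ite_eq (Finset.range (f.totalDegree + 1)) d]
  split_ifs with h
  · rfl
  · rw [Finset.mem_range, not_lt] at h
    rw [homogeneousComponent_eq_zero _ _ (by omega), map_zero]

lemma eval_smul_of_isHomogeneous {f : MvPolynomial (Fin 3) ℂ} {d : ℕ} (hf : f.IsHomogeneous d)
    (c : ℂ) (ξ : Fin 3 → ℂ) : eval (c • ξ) f = c ^ d * eval ξ f := by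
  rw [eval_eq, eval_eq, Finset.mul_sum]
  refine Finset.sum_congr rfl fun α hα => ?_
  have h := hf.degree_eq_sum_deg_support hα
  simp only [Pi.smul_apply, smul_eq_mul, mul_pow, Finset.prod_mul_distrib,
    Finset.prod_pow_eq_pow_sum]
  rw [← h]
  ring

end Polynomials

/-! ### SO(3) and scaling act transitively on nonzero isotropic vectors -/

section IsotropicCone

/-- The isotropic vector `(1, i, 0)`. -/
def isotropicVec : Fin 3 → ℂ := ![1, Complex.I, 0]

/-- The third column is the cross product of a and b, a unit vector by Lagrange's identity. -/
lemma exists_SO3_of_orthonormal (a b : Fin 3 → ℝ) (ha : a 0 ^ 2 + a 1 ^ 2 + a 2 ^ 2 = 1)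
    (hb : b 0 ^ 2 + b 1 ^ 2 + b 2 ^ 2 = 1) (hab : a 0 * b 0 + a 1 * b 1 + a 2 * b 2 = 0) :
    ∃ k : SO3, ∀ i, k.1 i 0 = a i ∧ k.1 i 1 = b i := by
  set M : Matrix (Fin 3) (Fin 3) ℝ := !![a 0, b 0, a 1 * b 2 - a 2 * b 1;
    a 1, b 1, a 2 * b 0 - a 0 * b 2; a 2, b 2, a 0 * b 1 - a 1 * b 0] with hM
  have hcross : (a 1 * b 2 - a 2 * b 1) ^ 2 + (a 2 * b 0 - a 0 * b 2) ^ 2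
      + (a 0 * b 1 - a 1 * b 0) ^ 2 = 1 := by
    linear_combination (b 0 ^ 2 + b 1 ^ 2 + b 2 ^ 2) * ha + hb
      - (a 0 * b 0 + a 1 * b 1 + a 2 * b 2) * hab
  refine ⟨⟨M, Matrix.mem_specialOrthogonalGroup_iff.2
    ⟨(Matrix.mem_orthogonalGroup_iff' _ _).2 ?_, ?_⟩⟩, fun i => ?_⟩
  · ext i j
    change (M.transpose * M) i j = _
    simp only [Matrix.mul_apply, Matrix.transpose_apply, Fin.sum_univ_three]
    fin_cases i <;> fin_cases j <;> simp [hM] <;> linarith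
  · rw [Matrix.det_fin_three]
    simp [hM]
    linarith
  · fin_cases i <;> simp [hM]

/-- Every isotropic vector of `ℂ³` is a multiple of a real rotation of `(1, i, 0)`. -/
lemma exists_eq_smul_rotateC_isotropicVec (ξ : Fin 3 → ℂ)
    (hξ : ξ 0 ^ 2 + ξ 1 ^ 2 + ξ 2 ^ 2 = 0) :
    ∃ (k : SO3) (c : ℂ), ξ = c • rotateC k isotropicVec := by
  -- Isotropy says that the real and imaginary parts of ξ are orthogonal and of the same length r.
  -- Divided by r they are the first two columns of k.
  have hre := congrArg Complex.re hξ
  have him := congrArg Complex.im hξ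
  simp [pow_two] at hre him
  set r := √((ξ 0).re ^ 2 + (ξ 1).re ^ 2 + (ξ 2).re ^ 2) with hr
  have hr2 : r ^ 2 = (ξ 0).re ^ 2 + (ξ 1).re ^ 2 + (ξ 2).re ^ 2 := Real.sq_sqrt (by positivity)
  by_cases h0 : r = 0
  · refine ⟨1, 0, ?_⟩
    rw [zero_smul]
    rw [h0] at hr2
    have e : ∀ i, (ξ i).re = 0 ∧ (ξ i).im = 0 := fun i => by
      fin_cases i <;> constructor <;> simp <;>
        nlinarith [sq_nonneg (ξ 0).re, sq_nonneg (ξ 1).re, sq_nonneg (ξ 2).re,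
          sq_nonneg (ξ 0).im, sq_nonneg (ξ 1).im, sq_nonneg (ξ 2).im]
    funext i
    exact Complex.ext (e i).1 (e i).2
  · obtain ⟨k, hk⟩ := exists_SO3_of_orthonormal (fun i => (ξ i).re / r) (fun i => (ξ i).im / r)
      (by field_simp; linarith) (by field_simp; linarith) (by field_simp; linarith)
    refine ⟨k, r, ?_⟩
    have hr0 : (r : ℂ) ≠ 0 := by exact_mod_cast h0
    funext i
    simp only [Pi.smul_apply, rotateC, isotropicVec, Fin.sum_univ_three, (hk i).1, (hk i).2,
      smul_eq_mul]
    push_cast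
    simp
    field_simp
    exact (Complex.re_add_im (ξ i)).symm.trans (by ring)

end IsotropicCone

/-! ### Differential operators, polynomials in ∂, and exponential test functions -/

section Operators

variable {V : Type*} [NormedAddCommGroup V] [InnerProductSpace ℂ V]

lemma SmoothFun.differentiableAt (u : SmoothFun V) (x : E3) : DifferentiableAt ℝ u.1 x :=
  ((SmoothFun.contDiff u).differentiable (by simp)) x

lemma partialOp_apply (i : Fin 3) (u : SmoothFun V) (x : E3) :
    (partialOp i u).1 x = fderiv ℝ u.1 x (EuclideanSpace.single i 1) := rfl

lemma translateOp_apply (y : E3) (u : SmoothFun V) (x : E3) :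
    (translateOp y u).1 x = u.1 (x - y) := rfl

lemma partialOp_mul_comm (i j : Fin 3) :
    (partialOp i * partialOp j : Module.End ℂ (SmoothFun V)) = partialOp j * partialOp i := by
  ext u x
  have hd : DifferentiableAt ℝ (fderiv ℝ u.1) x :=
    (((SmoothFun.contDiff u).fderiv_right (m := ∞) (by simp)).differentiable (by simp)) x
  have h : ∀ i j : Fin 3, ((partialOp i * partialOp j : Module.End ℂ (SmoothFun V)) u).1 x =
      fderiv ℝ (fderiv ℝ u.1) x (EuclideanSpace.single i 1) (EuclideanSpace.single j 1) := by
    intro i j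
    change fderiv ℝ (fun y => fderiv ℝ u.1 y (EuclideanSpace.single j 1)) x _ = _
    rw [fderiv_clm_apply hd (differentiableAt_const _)]
    simp
  rw [h, h]
  have hsymm : IsSymmSndFDerivAt ℝ u.1 x :=
    (SmoothFun.contDiff u).contDiffAt.isSymmSndFDerivAt (by simp [minSmoothness_of_isRCLikeNormedField]; exact WithTop.coe_le_coe.2 (le_top : (2 : ℕ∞) ≤ ⊤))
  exact hsymm _ _

/-- The coefficients are ℂ-linear maps but the derivative is real, so the product rule passes
through restriction of scalars. -/
lemma fderiv_clm_apply_complex {a : E3 → V →L[ℂ] V} {u : E3 → V} {x : E3}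
    (ha : DifferentiableAt ℝ a x) (hu : DifferentiableAt ℝ u x) (e : E3) :
    fderiv ℝ (fun y => a y (u y)) x e = fderiv ℝ a x e (u x) + a x (fderiv ℝ u x e) := by
  set L := ContinuousLinearMap.restrictScalarsL ℂ V V ℝ ℝ
  have h1 : HasFDerivAt (fun y => L (a y)) (L.comp (fderiv ℝ a x)) x :=
    L.hasFDerivAt.comp x ha.hasFDerivAt
  have h2 : HasFDerivAt (fun y => a y (u y)) _ x := h1.clm_apply hu.hasFDerivAt
  rw [h2.fderiv]
  simp [L, add_comm]

/-- The Leibniz rule. -/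
lemma partialOp_mul_mulOp (i : Fin 3) (a : E3 → V →L[ℂ] V) (ha : ContDiff ℝ ∞ a) :
    partialOp i * mulOp a ha =
      mulOp (fun x => fderiv ℝ a x (EuclideanSpace.single i 1))
        ((ha.fderiv_right (m := ∞) (by simp)).clm_apply contDiff_const)
        + mulOp a ha * partialOp i := by
  ext u x
  exact fderiv_clm_apply_complex (ha.differentiable (by simp) x) (SmoothFun.differentiableAt u x) _

lemma commute_partialOp_constOp (i : Fin 3) (A : V →L[ℂ] V) :
    Commute (partialOp i) (constOp A) := by
  ext u x
  have h := fderiv_clm_apply_complex (a := fun _ : E3 => A) (differentiableAt_const A)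
    (SmoothFun.differentiableAt u x) (EuclideanSpace.single i 1)
  rw [fderiv_fun_const, Pi.zero_apply, zero_apply, zero_apply, zero_add] at h
  exact h

lemma commute_partialOp_translateOp (i : Fin 3) (y : E3) :
    Commute (partialOp i : Module.End ℂ (SmoothFun V)) (translateOp y) := by
  ext u x
  change fderiv ℝ (fun x => u.1 (x - y)) x _ = fderiv ℝ u.1 (x - y) _
  rw [fderiv_comp_sub]

lemma commute_constOp_translateOp (A : V →L[ℂ] V) (y : E3) :
    Commute (constOp A) (translateOp y) := rfl

variable (V) in
/-- The constant-coefficient matrix operators `I ⊗ A`, as an algebra homomorphism. -/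
def constOpHom : (V →L[ℂ] V) →ₐ[ℂ] Module.End ℂ (SmoothFun V) where
  toFun := constOp
  map_one' := rfl
  map_mul' _ _ := rfl
  map_zero' := rfl
  map_add' _ _ := rfl
  commutes' _ := rfl

/-- The partial derivatives commute, so they generate a commutative algebra, into which polynomials
can be evaluated. -/
lemma exists_polynomial_partialOp : ∃ φ : MvPolynomial (Fin 3) ℂ →ₐ[ℂ] Module.End ℂ (SmoothFun V),
    ∀ i, φ (MvPolynomial.X i) = partialOp i := by
  have hcomm := Algebra.isMulCommutative_adjoin ℂ (s := Set.range (partialOp (V := V))) (by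
    rintro _ ⟨i, rfl⟩ _ ⟨j, rfl⟩
    exact partialOp_mul_comm i j)
  let _ : CommSemiring (Algebra.adjoin ℂ (Set.range (partialOp (V := V)))) :=
    { (Algebra.adjoin ℂ (Set.range (partialOp (V := V)))).toSemiring with
      mul_comm := hcomm.1.1 }
  refine ⟨(Algebra.adjoin ℂ (Set.range (partialOp (V := V)))).val.comp
    (MvPolynomial.aeval fun i => ⟨partialOp i, Algebra.subset_adjoin ⟨i, rfl⟩⟩), fun i => ?_⟩
  simp

variable (V) in
/-- The scalar differential operator `f(∂)` with constant coefficients. -/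
def polyOp : MvPolynomial (Fin 3) ℂ →ₐ[ℂ] Module.End ℂ (SmoothFun V) :=
  exists_polynomial_partialOp.choose

lemma polyOp_X (i : Fin 3) : polyOp V (MvPolynomial.X i) = partialOp i :=
  exists_polynomial_partialOp.choose_spec i

lemma polyOp_mem (S : Subalgebra ℂ (Module.End ℂ (SmoothFun V))) (h : ∀ i, partialOp i ∈ S)
    (f : MvPolynomial (Fin 3) ℂ) : polyOp V f ∈ S := by
  induction f using MvPolynomial.induction_on with
  | C a => rw [← MvPolynomial.algebraMap_eq, AlgHom.commutes]; exact S.algebraMap_mem a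
  | add p q hp hq => rw [map_add]; exact S.add_mem hp hq
  | mul_X p i hp => rw [map_mul, polyOp_X]; exact S.mul_mem hp (h i)

lemma commute_polyOp {T : Module.End ℂ (SmoothFun V)} (hT : ∀ i, Commute (partialOp i) T)
    (f : MvPolynomial (Fin 3) ℂ) : Commute (polyOp V f) T := by
  have h := polyOp_mem (Subalgebra.centralizer ℂ {T}) (fun i => by
    rw [Subalgebra.mem_centralizer_iff]
    rintro _ rfl
    exact (hT i).eq.symm) f
  exact ((Subalgebra.mem_centralizer_iff ℂ).1 h T rfl).symm

/-- Differential operators are spanned by the operators `M_a f(∂)`. -/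
lemma mem_span_of_mem_diffOps {D : Module.End ℂ (SmoothFun V)} (hD : D ∈ diffOps V) :
    D ∈ Submodule.span ℂ {D | ∃ a, ∃ ha : ContDiff ℝ ∞ a, ∃ f, D = mulOp a ha * polyOp V f} := by
  set S := Submodule.span ℂ {D : Module.End ℂ (SmoothFun V) |
    ∃ a, ∃ ha : ContDiff ℝ ∞ a, ∃ f, D = mulOp a ha * polyOp V f} with hS
  have hgen : ∀ a ha f, mulOp a ha * polyOp V f ∈ S := fun a ha f =>
    Submodule.subset_span ⟨a, ha, f, rfl⟩
  have key : ∀ T : Module.End ℂ (SmoothFun V), (∀ a ha f, T * (mulOp a ha * polyOp V f) ∈ S) →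
      ∀ D ∈ S, T * D ∈ S := by
    intro T hT D hD
    have : S ≤ S.comap (LinearMap.mulLeft ℂ T) :=
      Submodule.span_le.2 (by rintro _ ⟨a, ha, f, rfl⟩; exact hT a ha f)
    exact this hD
  -- Left multiplication by D preserves the span, the Leibniz rule moving ∂ past a coefficient.
  -- Applied to 1 this gives D itself.
  have hstab : ∀ D' ∈ S, D * D' ∈ S := by
    unfold diffOps at hD
    induction hD using Algebra.adjoin_induction with
    | mem T hT =>
      refine key T fun a ha f => ?_
      rcases hT with ⟨i, rfl⟩ | ⟨b, hb, rfl⟩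
      · rw [← mul_assoc, partialOp_mul_mulOp, add_mul, mul_assoc, ← polyOp_X, ← map_mul]
        exact S.add_mem (hgen _ _ _) (hgen _ _ _)
      · rw [← mul_assoc]
        exact hgen (fun x => b x * a x) (hb.mul ha) f
    | algebraMap c =>
      intro D' hD'
      rw [← Algebra.smul_def]
      exact S.smul_mem c hD'
    | add T U _ _ hT hU =>
      intro D' hD'
      rw [add_mul]
      exact S.add_mem (hT D' hD') (hU D' hD')
    | mul T U _ _ hT hU =>
      intro D' hD'
      rw [mul_assoc]
      exact hT _ (hU D' hD')
  have hone : (1 : Module.End ℂ (SmoothFun V)) ∈ S := by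
    have h := hgen (fun _ => 1) contDiff_const 1
    rwa [map_one, mul_one] at h
  rw [← mul_one D]
  exact hstab 1 hone

/-- The exponential `x ↦ e^{ξ·x} v`. -/
def expFun (ξ : Fin 3 → ℂ) (v : V) : SmoothFun V :=
  ⟨fun x => Complex.exp (∑ i, ξ i * (x i : ℂ)) • v, by
    have h : ∀ i, ContDiff ℝ ∞ fun x : E3 => ξ i * (x i : ℂ) := fun i =>
      contDiff_const.mul (Complex.ofRealCLM.comp (EuclideanSpace.proj (𝕜 := ℝ) i)).contDiff
    exact (ContDiff.sum fun i _ => h i).cexp.smul contDiff_const⟩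

lemma expFun_apply (ξ : Fin 3 → ℂ) (v : V) (x : E3) :
    (expFun ξ v).1 x = Complex.exp (∑ i, ξ i * (x i : ℂ)) • v := rfl

lemma expFun_apply_zero (ξ : Fin 3 → ℂ) (v : V) : (expFun ξ v).1 0 = v := by
  simp [expFun_apply]

lemma expFun_smul (ξ : Fin 3 → ℂ) (c : ℂ) (v : V) : expFun ξ (c • v) = c • expFun ξ v :=
  Subtype.ext (funext fun _ => smul_comm _ _ _)

lemma expFun_add (ξ : Fin 3 → ℂ) (v w : V) : expFun ξ (v + w) = expFun ξ v + expFun ξ w :=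
  Subtype.ext (funext fun _ => smul_add _ _ _)

lemma constOp_expFun (A : V →L[ℂ] V) (ξ : Fin 3 → ℂ) (v : V) :
    constOp A (expFun ξ v) = expFun ξ (A v) :=
  Subtype.ext (funext fun _ => map_smul A _ _)

lemma partialOp_expFun (i : Fin 3) (ξ : Fin 3 → ℂ) (v : V) :
    partialOp i (expFun ξ v) = expFun ξ (ξ i • v) := by
  refine Subtype.ext (funext fun x => ?_)
  have h1 : HasFDerivAt (fun x : E3 => ∑ j, ξ j * (x j : ℂ))
      (∑ j, ξ j • Complex.ofRealCLM.comp (EuclideanSpace.proj (𝕜 := ℝ) j)) x := by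
    refine HasFDerivAt.fun_sum fun j _ => HasFDerivAt.const_mul ?_ (ξ j)
    exact (Complex.ofRealCLM.comp (EuclideanSpace.proj (𝕜 := ℝ) j)).hasFDerivAt
  have h2 := h1.cexp.smul_const v
  rw [partialOp_apply, expFun_apply]
  change fderiv ℝ (fun x : E3 => Complex.exp (∑ j, ξ j * (x j : ℂ)) • v) x _ = _
  rw [h2.fderiv]
  simp only [ContinuousLinearMap.smulRight_apply, smul_apply, sum_apply]
  simp [smul_smul, apply_ite]

lemma polyOp_expFun (f : MvPolynomial (Fin 3) ℂ) (ξ : Fin 3 → ℂ) (v : V) :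
    polyOp V f (expFun ξ v) = expFun ξ (MvPolynomial.eval ξ f • v) := by
  induction f using MvPolynomial.induction_on generalizing v with
  | C a =>
    rw [← MvPolynomial.algebraMap_eq, AlgHom.commutes, Module.algebraMap_end_apply,
      MvPolynomial.algebraMap_eq, MvPolynomial.eval_C, expFun_smul]
  | add p q hp hq => rw [map_add, LinearMap.add_apply, hp, hq, ← expFun_add, map_add, add_smul]
  | mul_X p i hp =>
    rw [map_mul, polyOp_X, Module.End.mul_apply, partialOp_expFun, hp, map_mul,
      MvPolynomial.eval_X, mul_smul]

end Operators

/-! ### Rotations acting on exponentials, derivatives and constant matrices -/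

section Rotations

variable {V : Type*} [NormedAddCommGroup V] [InnerProductSpace ℂ V] [FiniteDimensional ℂ V]
  (τ : Representation ℂ SO3 V)

lemma rotateOp_apply (k : SO3) (u : SmoothFun V) (x : E3) :
    (rotateOp τ k u).1 x = τ k (u.1 (rotate k⁻¹ x)) := rfl

lemma rotate_inv_apply (k : SO3) (x : E3) (i : Fin 3) :
    rotate k⁻¹ x i = ∑ j, k.1 j i * x j := rfl

lemma rotate_inv_single (k : SO3) (i : Fin 3) :
    rotate k⁻¹ (EuclideanSpace.single i 1) = ∑ j, k.1 i j • EuclideanSpace.single j (1 : ℝ) := by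
  ext l
  rw [rotate_inv_apply]
  simp [Pi.single_apply]

lemma rotateOp_expFun (k : SO3) (ξ : Fin 3 → ℂ) (v : V) :
    rotateOp τ k (expFun ξ v) = expFun (rotateC k ξ) (τ k v) := by
  refine Subtype.ext (funext fun x => ?_)
  rw [rotateOp_apply, expFun_apply, expFun_apply, map_smul]
  congr 2
  simp only [rotate_inv_apply, rotateC, Fin.sum_univ_three]
  push_cast
  ring

lemma partialOp_mul_rotateOp (k : SO3) (i : Fin 3) :
    partialOp i * rotateOp τ k = rotateOp τ k * ∑ j, (k.1 i j : ℂ) • partialOp j := by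
  ext u x
  have h : HasFDerivAt (fun x => opOf τ k (u.1 (rotate k⁻¹ x)))
      (((opOf τ k).restrictScalars ℝ).comp ((fderiv ℝ u.1 (rotate k⁻¹ x)).comp (rotate k⁻¹))) x :=
    ((opOf τ k).restrictScalars ℝ).hasFDerivAt.comp x
      ((SmoothFun.differentiableAt u _).hasFDerivAt.comp x (rotate k⁻¹).hasFDerivAt)
  change fderiv ℝ (fun x => opOf τ k (u.1 (rotate k⁻¹ x))) x _ = _
  rw [h.fderiv]
  simp only [ContinuousLinearMap.comp_apply, rotate_inv_single, map_sum, map_smul,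
    Module.End.mul_apply, rotateOp_apply, LinearMap.sum_apply, LinearMap.smul_apply,
    Submodule.coe_sum, Finset.sum_apply, Submodule.coe_smul, Pi.smul_apply, partialOp_apply]
  rfl

lemma constOp_mul_rotateOp (k : SO3) (A : V →L[ℂ] V) :
    constOp A * rotateOp τ k = rotateOp τ k * constOp (opOf τ k⁻¹ * A * opOf τ k) := by
  ext u x
  have h : opOf τ k * (opOf τ k⁻¹ * A * opOf τ k) = A * opOf τ k := by
    rw [← mul_assoc, ← mul_assoc, opOf_mul_inv, one_mul]
  exact (DFunLike.congr_fun h (u.1 (rotate k⁻¹ x))).symm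

end Rotations

/-! ### Symbols of constant-coefficient operators -/

section Symbols

open MvPolynomial TensorProduct

variable {V : Type*} [NormedAddCommGroup V] [InnerProductSpace ℂ V] [FiniteDimensional ℂ V]

variable (V) in
/-- The isomorphism of a matrix algebra with `End(V)` given by a basis of `V`. -/
def matrixEquivOp : Matrix (Fin (Module.finrank ℂ V)) (Fin (Module.finrank ℂ V)) ℂ ≃ₐ[ℂ] (V →L[ℂ] V) :=
  (Matrix.toLinAlgEquiv (Module.finBasis ℂ V)).trans (Module.End.toContinuousLinearMap V)

variable (V) in
/-- Polynomials on `ℂ³` with values in `End(V)`, as matrices of polynomials. -/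
abbrev PolySymbol : Type :=
  Matrix (Fin (Module.finrank ℂ V)) (Fin (Module.finrank ℂ V)) (MvPolynomial (Fin 3) ℂ)

/-- The constant symbols. -/
def constSymbol : (V →L[ℂ] V) →ₐ[ℂ] PolySymbol V :=
  (AlgHom.mapMatrix (Algebra.ofId ℂ (MvPolynomial (Fin 3) ℂ))).comp (matrixEquivOp V).symm.toAlgHom

/-- Evaluation of a symbol at `ξ ∈ ℂ³`. -/
def evalSymbol (ξ : Fin 3 → ℂ) : PolySymbol V →ₐ[ℂ] (V →L[ℂ] V) :=
  (matrixEquivOp V).toAlgHom.comp (AlgHom.mapMatrix (aeval ξ))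

/-- The substitution of a rotation into a symbol. -/
def rotateSymbol (k : SO3) : PolySymbol V →ₐ[ℂ] PolySymbol V :=
  AlgHom.mapMatrix (substRotate k)

lemma commute_polyOp_constOpHom (f : MvPolynomial (Fin 3) ℂ)
    (A : Matrix (Fin (Module.finrank ℂ V)) (Fin (Module.finrank ℂ V)) ℂ) :
    Commute (polyOp V f) ((constOpHom V).comp (matrixEquivOp V).toAlgHom A) :=
  commute_polyOp (fun i => commute_partialOp_constOp i _) f

/-- The constant-coefficient operator with a given symbol. -/
def symbolOp : PolySymbol V →ₐ[ℂ] Module.End ℂ (SmoothFun V) :=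
  (Algebra.TensorProduct.lift (polyOp V) ((constOpHom V).comp (matrixEquivOp V).toAlgHom)
    commute_polyOp_constOpHom).comp
    (matrixEquivTensor (Fin (Module.finrank ℂ V)) ℂ (MvPolynomial (Fin 3) ℂ)).toAlgHom

lemma smul_constSymbol_eq (f : MvPolynomial (Fin 3) ℂ) (T : V →L[ℂ] V) :
    f • constSymbol T =
      (matrixEquivTensor (Fin (Module.finrank ℂ V)) ℂ (MvPolynomial (Fin 3) ℂ)).symm
        (f ⊗ₜ (matrixEquivOp V).symm T) := by
  rw [matrixEquivTensor_apply_symm]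
  rfl

/-- Matrices of polynomials form ℂ[ξ] ⊗ End(V), which is additively spanned by pure tensors. -/
lemma PolySymbol.induction {p : PolySymbol V → Prop} (zero : p 0)
    (add : ∀ M N, p M → p N → p (M + N))
    (smul : ∀ (f : MvPolynomial (Fin 3) ℂ) (T : V →L[ℂ] V), p (f • constSymbol T))
    (M : PolySymbol V) : p M := by
  obtain ⟨t, rfl⟩ := (matrixEquivTensor (Fin (Module.finrank ℂ V)) ℂ
    (MvPolynomial (Fin 3) ℂ)).symm.surjective M
  induction t using TensorProduct.induction_on with
  | zero => rw [map_zero]; exact zero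
  | tmul f A =>
    have h := smul f (matrixEquivOp V A)
    rwa [smul_constSymbol_eq, AlgEquiv.symm_apply_apply] at h
  | add x y hx hy => rw [map_add]; exact add _ _ hx hy

lemma symbolOp_smul_constSymbol (f : MvPolynomial (Fin 3) ℂ) (T : V →L[ℂ] V) :
    symbolOp (f • constSymbol T) = polyOp V f * constOp T := by
  rw [smul_constSymbol_eq]
  change Algebra.TensorProduct.lift (polyOp V) ((constOpHom V).comp (matrixEquivOp V).toAlgHom)
    commute_polyOp_constOpHom (matrixEquivTensor _ ℂ _
    ((matrixEquivTensor _ ℂ _).symm (f ⊗ₜ (matrixEquivOp V).symm T))) = _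
  rw [AlgEquiv.apply_symm_apply, Algebra.TensorProduct.lift_tmul]
  change polyOp V f * constOp (matrixEquivOp V ((matrixEquivOp V).symm T)) = _
  rw [AlgEquiv.apply_symm_apply]

lemma symbolOp_smul (f : MvPolynomial (Fin 3) ℂ) (M : PolySymbol V) :
    symbolOp (f • M) = polyOp V f * symbolOp M := by
  induction M using PolySymbol.induction with
  | zero => simp
  | add M N hM hN => rw [smul_add, map_add, map_add, hM, hN, mul_add]
  | smul g T => rw [smul_smul, symbolOp_smul_constSymbol, symbolOp_smul_constSymbol, map_mul, mul_assoc]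

lemma evalSymbol_smul (ξ : Fin 3 → ℂ) (f : MvPolynomial (Fin 3) ℂ) (M : PolySymbol V) :
    evalSymbol ξ (f • M) = eval ξ f • evalSymbol ξ M := by
  change matrixEquivOp V (AlgHom.mapMatrix (aeval ξ) (f • M)) =
    eval ξ f • matrixEquivOp V (AlgHom.mapMatrix (aeval ξ) M)
  rw [← map_smul]
  congr 1
  ext i j
  simp [Matrix.smul_apply]

lemma evalSymbol_constSymbol (ξ : Fin 3 → ℂ) (T : V →L[ℂ] V) : evalSymbol ξ (constSymbol T) = T := by
  change matrixEquivOp V (AlgHom.mapMatrix (aeval ξ) (AlgHom.mapMatrix (Algebra.ofId _ _)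
    ((matrixEquivOp V).symm T))) = T
  conv_rhs => rw [← (matrixEquivOp V).apply_symm_apply T]
  congr 1
  ext i j
  simp [Algebra.ofId_apply]

lemma evalSymbol_rotateSymbol (ξ : Fin 3 → ℂ) (k : SO3) (M : PolySymbol V) :
    evalSymbol ξ (rotateSymbol k M) = evalSymbol (rotateC k ξ) M := by
  change matrixEquivOp V (AlgHom.mapMatrix (aeval ξ) (AlgHom.mapMatrix (substRotate k) M)) =
    matrixEquivOp V (AlgHom.mapMatrix (aeval (rotateC k ξ)) M)
  congr 1
  ext i j
  exact eval_substRotate k ξ (M i j)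

lemma eval_eq_zero_of_evalSymbol_eq_zero {ξ : Fin 3 → ℂ} {M : PolySymbol V}
    (h : evalSymbol ξ M = 0) (i j) : eval ξ (M i j) = 0 := by
  have h' : AlgHom.mapMatrix (aeval ξ) M = 0 := (map_eq_zero_iff _ (matrixEquivOp V).injective).1 h
  exact congrFun (congrFun h' i) j

lemma PolySymbol.ext_evalSymbol {M N : PolySymbol V} (h : ∀ ξ, evalSymbol ξ M = evalSymbol ξ N) :
    M = N := by
  rw [← sub_eq_zero]
  ext1 i j
  refine MvPolynomial.funext fun ξ => ?_
  rw [eval_eq_zero_of_evalSymbol_eq_zero (by rw [map_sub, h, sub_self]) i j, Matrix.zero_apply,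
    map_zero]

lemma symbolOp_expFun (M : PolySymbol V) (ξ : Fin 3 → ℂ) (v : V) :
    symbolOp M (expFun ξ v) = expFun ξ (evalSymbol ξ M v) := by
  induction M using PolySymbol.induction with
  | zero =>
    rw [map_zero, map_zero, LinearMap.zero_apply, zero_apply, ← zero_smul ℂ (0 : V), expFun_smul,
      zero_smul]
  | add M N hM hN => rw [map_add, map_add, LinearMap.add_apply, hM, hN, add_apply, expFun_add]
  | smul f T =>
    rw [symbolOp_smul_constSymbol, Module.End.mul_apply, constOp_expFun, polyOp_expFun,
      evalSymbol_smul, evalSymbol_constSymbol]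
    rfl

lemma commute_symbolOp_translateOp (M : PolySymbol V) (y : E3) :
    Commute (symbolOp M) (translateOp y) := by
  induction M using PolySymbol.induction with
  | zero => rw [map_zero]; exact Commute.zero_left _
  | add M N hM hN => rw [map_add]; exact hM.add_left hN
  | smul f T =>
    rw [symbolOp_smul_constSymbol]
    exact (commute_polyOp (fun i => commute_partialOp_translateOp i y) f).mul_left
      (commute_constOp_translateOp T y)

lemma symbolOp_mem_diffOps (M : PolySymbol V) : symbolOp M ∈ diffOps V := by
  induction M using PolySymbol.induction with
  | zero => rw [map_zero]; exact Subalgebra.zero_mem _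
  | add M N hM hN => rw [map_add]; exact Subalgebra.add_mem _ hM hN
  | smul f T =>
    rw [symbolOp_smul_constSymbol]
    exact Subalgebra.mul_mem _
      (polyOp_mem _ (fun i => Algebra.subset_adjoin (Or.inl ⟨i, rfl⟩)) f)
      (Algebra.subset_adjoin (Or.inr ⟨_, _, rfl⟩))

/-- A translation-invariant differential operator has constant coefficients. -/
lemma exists_symbol_of_commute_translateOp {D : Module.End ℂ (SmoothFun V)} (hD : D ∈ diffOps V)
    (ht : ∀ y, Commute D (translateOp y)) : ∃ M : PolySymbol V, D = symbolOp M := by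
  -- Freeze the coefficients at the origin: M_a f(∂) and a(0) f(∂) give functions with the same
  -- value at 0.
  have hpt : ∃ M : PolySymbol V, ∀ u, (D u).1 0 = (symbolOp M u).1 0 := by
    have hD' := mem_span_of_mem_diffOps hD
    clear ht hD
    induction hD' using Submodule.span_induction with
    | mem D h =>
      obtain ⟨a, ha, f, rfl⟩ := h
      refine ⟨f • constSymbol (a 0), fun u => ?_⟩
      rw [symbolOp_smul_constSymbol,
        (commute_polyOp (fun i => commute_partialOp_constOp i _) f).eq]
      rfl
    | zero => exact ⟨0, fun u => by rw [map_zero]⟩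
    | add D E _ _ hD hE =>
      obtain ⟨M, hM⟩ := hD
      obtain ⟨N, hN⟩ := hE
      refine ⟨M + N, fun u => ?_⟩
      rw [map_add]
      exact congrArg₂ (· + ·) (hM u) (hN u)
    | smul c D _ hD =>
      obtain ⟨M, hM⟩ := hD
      refine ⟨c • M, fun u => ?_⟩
      rw [map_smul]
      exact congrArg (c • ·) (hM u)
  obtain ⟨M, hM⟩ := hpt
  refine ⟨M, ?_⟩
  ext u x
  -- An operator commuting with translations is determined by its values at the origin.
  have h : ∀ T : Module.End ℂ (SmoothFun V), (∀ y, Commute T (translateOp y)) →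
      (T u).1 x = (T (translateOp (-x) u)).1 0 := fun T hT => by
    have h1 := LinearMap.congr_fun (hT (-x)).eq u
    rw [Module.End.mul_apply, Module.End.mul_apply] at h1
    rw [h1, translateOp_apply, sub_neg_eq_add, zero_add]
  rw [h D ht, h _ (commute_symbolOp_translateOp M), hM]

lemma symbolOp_normSqPoly : symbolOp (normSqPoly • (1 : PolySymbol V)) = laplacianOp := by
  rw [symbolOp_smul, map_one, mul_one]
  ext u x
  change _ = Laplacian.laplacian u.1 x
  rw [laplacian_eq_sum_partialOp]
  simp only [normSqPoly, map_add, map_mul, polyOp_X, pow_two, Fin.sum_univ_three]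

end Symbols

/-! ### Equivariant and homogeneous symbols -/

section InvariantSymbols

open MvPolynomial

variable {V : Type*} [NormedAddCommGroup V] [InnerProductSpace ℂ V] [FiniteDimensional ℂ V]
  {τ : Representation ℂ SO3 V}

lemma polyOp_mul_rotateOp (k : SO3) (f : MvPolynomial (Fin 3) ℂ) :
    polyOp V f * rotateOp τ k = rotateOp τ k * polyOp V (substRotate k f) := by
  induction f using MvPolynomial.induction_on with
  | C a =>
    rw [← MvPolynomial.algebraMap_eq, AlgHom.commutes, AlgHom.commutes, AlgHom.commutes]
    exact Algebra.commutes a _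
  | add p q hp hq => rw [map_add, map_add, map_add, add_mul, hp, hq, mul_add]
  | mul_X p i hp =>
    have hX : polyOp V (substRotate k (X i)) = ∑ j, (k.1 i j : ℂ) • partialOp j := by
      simp only [substRotate, aeval_X, map_sum]
      refine Finset.sum_congr rfl fun j _ => ?_
      rw [C_mul', map_smul, polyOp_X]
    rw [map_mul, map_mul, map_mul, polyOp_X, mul_assoc, partialOp_mul_rotateOp, ← mul_assoc, hp, hX,
      mul_assoc]

lemma symbolOp_mul_rotateOp (k : SO3) (M : PolySymbol V) :
    symbolOp M * rotateOp τ k = rotateOp τ k *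
      symbolOp (constSymbol (opOf τ k⁻¹) * rotateSymbol k M * constSymbol (opOf τ k)) := by
  induction M using PolySymbol.induction with
  | zero => simp
  | add M N hM hN => rw [map_add, map_add, add_mul, hM, hN, mul_add, add_mul, map_add, mul_add]
  | smul f T =>
    have h : rotateSymbol k (f • constSymbol T) = substRotate k f • constSymbol T :=
      PolySymbol.ext_evalSymbol fun ξ => by
        rw [evalSymbol_rotateSymbol, evalSymbol_smul, evalSymbol_smul, evalSymbol_constSymbol,
          evalSymbol_constSymbol, eval_substRotate]
    rw [symbolOp_smul_constSymbol, h, mul_smul_comm, smul_mul_assoc, ← map_mul, ← map_mul,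
      symbolOp_smul_constSymbol, mul_assoc, constOp_mul_rotateOp, ← mul_assoc,
      polyOp_mul_rotateOp, mul_assoc]

variable (τ) in
/-- The symbols that are equivariant for the action of `SO(3)`. -/
def IsEquivariant (M : PolySymbol V) : Prop :=
  ∀ k, rotateSymbol k M * constSymbol (opOf τ k) = constSymbol (opOf τ k) * M

lemma IsEquivariant.evalSymbol_rotateC {M : PolySymbol V} (hM : IsEquivariant τ M) (k : SO3)
    (ξ : Fin 3 → ℂ) : evalSymbol (rotateC k ξ) M * opOf τ k = opOf τ k * evalSymbol ξ M := by
  have h := congrArg (evalSymbol ξ) (hM k)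
  rwa [map_mul, map_mul, evalSymbol_rotateSymbol, evalSymbol_constSymbol] at h

lemma IsEquivariant.commute_rotateOp {M : PolySymbol V} (hM : IsEquivariant τ M) (k : SO3) :
    Commute (symbolOp M) (rotateOp τ k) := by
  change _ = _
  rw [symbolOp_mul_rotateOp, mul_assoc, hM k, ← mul_assoc, ← map_mul, opOf_inv_mul, map_one,
    one_mul]

/-- Test on e^{ξ·x}v, which k sends to e^{kξ·x}τ(k)v, and evaluate at x = 0 to read off the symbol.
-/
lemma isEquivariant_of_commute_rotateOp {M : PolySymbol V}
    (hM : ∀ k, Commute (symbolOp M) (rotateOp τ k)) : IsEquivariant τ M := by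
  refine fun k => PolySymbol.ext_evalSymbol fun ξ => ?_
  rw [map_mul, map_mul, evalSymbol_rotateSymbol, evalSymbol_constSymbol]
  ext v
  have h := LinearMap.congr_fun (hM k).eq (expFun ξ v)
  rw [Module.End.mul_apply, Module.End.mul_apply, rotateOp_expFun, symbolOp_expFun,
    symbolOp_expFun, rotateOp_expFun] at h
  have h0 := congrArg (fun u : SmoothFun V => u.1 0) h
  simp only [expFun_apply_zero] at h0
  exact h0

/-- The symbol of `D_τ`. -/
def dtauSymbol (τ : Representation ℂ SO3 V) : PolySymbol V :=
  ∑ i, (X i : MvPolynomial (Fin 3) ℂ) • constSymbol (derivedRep τ (basisY i))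

lemma symbolOp_dtauSymbol : symbolOp (dtauSymbol τ) = Dtau τ := by
  simp only [dtauSymbol, Dtau, map_sum, symbolOp_smul_constSymbol, polyOp_X]

lemma evalSymbol_dtauSymbol (ξ : Fin 3 → ℂ) :
    evalSymbol ξ (dtauSymbol τ) = ∑ i, ξ i • derivedRep τ (basisY i) := by
  simp only [dtauSymbol, map_sum, evalSymbol_smul, evalSymbol_constSymbol, eval_X]

lemma evalSymbol_isotropicVec_dtauSymbol :
    evalSymbol isotropicVec (dtauSymbol τ) = raisingOp τ := by
  simp [evalSymbol_dtauSymbol, Fin.sum_univ_three, isotropicVec, raisingOp]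

lemma isEquivariant_dtauSymbol [Nontrivial V] (hc : ∀ v : V, Continuous fun k : SO3 => τ k v) :
    IsEquivariant τ (dtauSymbol τ) := by
  refine fun k => PolySymbol.ext_evalSymbol fun ξ => ?_
  rw [map_mul, map_mul, evalSymbol_rotateSymbol, evalSymbol_constSymbol, evalSymbol_dtauSymbol,
    evalSymbol_dtauSymbol]
  have h : ∀ l, opOf τ k * derivedRep τ (basisY l) =
      (∑ j, (k.1 j l : ℂ) • derivedRep τ (basisY j)) * opOf τ k := fun l => by
    have h1 := opOf_mul_derivedRep_basisY hc k l
    calc opOf τ k * derivedRep τ (basisY l)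
        = opOf τ k * derivedRep τ (basisY l) * opOf τ k⁻¹ * opOf τ k := by
          rw [mul_assoc _ _ (opOf τ k), opOf_inv_mul, mul_one]
      _ = _ := by rw [h1]; rfl
  simp only [Finset.mul_sum, mul_smul_comm, h, rotateC, Finset.sum_smul, Finset.sum_mul,
    smul_mul_assoc, Finset.smul_sum, smul_smul]
  rw [Finset.sum_comm]
  exact Finset.sum_congr rfl fun i _ => Finset.sum_congr rfl fun j _ => by rw [mul_comm]

lemma isEquivariant_normSqPoly : IsEquivariant τ (normSqPoly • (1 : PolySymbol V)) := by
  refine fun k => PolySymbol.ext_evalSymbol fun ξ => ?_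
  rw [map_mul, map_mul, evalSymbol_rotateSymbol, evalSymbol_constSymbol, evalSymbol_smul,
    evalSymbol_smul, ← eval_substRotate, substRotate_normSqPoly, map_one, map_one, smul_mul_assoc,
    mul_smul_comm, one_mul, mul_one]

lemma IsEquivariant.pow {M : PolySymbol V} (hM : IsEquivariant τ M) (d : ℕ) :
    IsEquivariant τ (M ^ d) :=
  isEquivariant_of_commute_rotateOp fun k => by
    rw [map_pow]; exact (hM.commute_rotateOp k).pow_left d

lemma IsEquivariant.sub_smul {M N : PolySymbol V} (hM : IsEquivariant τ M)
    (hN : IsEquivariant τ N) (c : ℂ) : IsEquivariant τ (M - c • N) := fun k => by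
  rw [map_sub, map_smul, sub_mul, smul_mul_assoc, hM k, hN k, mul_sub, mul_smul_comm]

/-- The form is rotation-invariant and nonzero, and polynomials form a domain, so it cancels entry
by entry. -/
lemma IsEquivariant.of_normSqPoly_smul {M : PolySymbol V}
    (hM : IsEquivariant τ (normSqPoly • M)) : IsEquivariant τ M := fun k => by
  have h := hM k
  have h1 : rotateSymbol k (normSqPoly • M) = normSqPoly • rotateSymbol k M := by
    ext1 i j
    change substRotate k (normSqPoly * M i j) = normSqPoly * substRotate k (M i j)
    rw [map_mul, substRotate_normSqPoly]
  rw [h1, smul_mul_assoc, mul_smul_comm] at h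
  ext1 i j
  exact mul_left_cancel₀ normSqPoly_ne_zero (congrFun (congrFun h i) j)

lemma IsEquivariant.map_homogeneousComponent {M : PolySymbol V} (hM : IsEquivariant τ M) (d : ℕ) :
    IsEquivariant τ (M.map (homogeneousComponent d)) := fun k => by
  have h := congrArg (fun N : PolySymbol V => N.map (homogeneousComponent d)) (hM k)
  have hC : ∀ (T : V →L[ℂ] V) i j, constSymbol T i j = C ((matrixEquivOp V).symm T i j) :=
    fun _ _ _ => rfl
  ext1 i j
  have hij := congrFun (congrFun h i) j
  simp only [Matrix.map_apply, Matrix.mul_apply, hC, map_sum, homogeneousComponent_C_mul] at hij ⊢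
  rw [← hij]
  refine Finset.sum_congr rfl fun l _ => ?_
  rw [mul_comm (rotateSymbol k M i l), homogeneousComponent_C_mul, mul_comm]
  congr 1
  exact (homogeneousComponent_substRotate k d (M i l)).symm

/-- Symbols all of whose entries are homogeneous of degree `d`. -/
def IsHomogeneousSymbol (d : ℕ) (M : PolySymbol V) : Prop := ∀ i j, (M i j).IsHomogeneous d

lemma IsHomogeneousSymbol.evalSymbol_smul {d : ℕ} {M : PolySymbol V} (hM : IsHomogeneousSymbol d M)
    (c : ℂ) (ξ : Fin 3 → ℂ) : evalSymbol (c • ξ) M = c ^ d • evalSymbol ξ M := by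
  change matrixEquivOp V (AlgHom.mapMatrix (aeval (c • ξ)) M) =
    c ^ d • matrixEquivOp V (AlgHom.mapMatrix (aeval ξ) M)
  rw [← map_smul]
  congr 1
  ext i j
  exact eval_smul_of_isHomogeneous (hM i j) c ξ

omit [FiniteDimensional ℂ V] in
lemma IsHomogeneousSymbol.sub_smul {d : ℕ} {M N : PolySymbol V} (hM : IsHomogeneousSymbol d M)
    (hN : IsHomogeneousSymbol d N) (c : ℂ) : IsHomogeneousSymbol d (M - c • N) := fun i j => by
  rw [Matrix.sub_apply, Matrix.smul_apply, smul_eq_C_mul]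
  exact (hM i j).sub ((hN i j).C_mul c)

omit [FiniteDimensional ℂ V] in
lemma IsHomogeneousSymbol.mul {d e : ℕ} {M N : PolySymbol V} (hM : IsHomogeneousSymbol d M)
    (hN : IsHomogeneousSymbol e N) : IsHomogeneousSymbol (d + e) (M * N) := fun i j => by
  rw [Matrix.mul_apply]
  exact IsHomogeneous.sum _ _ _ fun l _ => (hM i l).mul (hN l j)

lemma isHomogeneousSymbol_dtauSymbol_pow (d : ℕ) : IsHomogeneousSymbol d (dtauSymbol τ ^ d) := by
  induction d with
  | zero =>
    intro i j
    rw [pow_zero, Matrix.one_apply]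
    split_ifs
    · exact isHomogeneous_one _ _
    · exact isHomogeneous_zero _ _ _
  | succ d ih =>
    rw [pow_succ]
    refine ih.mul fun i j => ?_
    rw [dtauSymbol, Matrix.sum_apply]
    refine IsHomogeneous.sum _ _ _ fun l _ => ?_
    have : constSymbol (derivedRep τ (basisY l)) i j
      = C ((matrixEquivOp V).symm (derivedRep τ (basisY l)) i j) := rfl
    rw [Matrix.smul_apply, this, smul_eq_mul, mul_comm]
    exact isHomogeneous_C_mul_X _ _

end InvariantSymbols

/-! ### Infinitesimal equivariance at the isotropic vector -/

section HighestWeight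

open MvPolynomial

attribute [local instance] Matrix.linftyOpNormedRing Matrix.linftyOpNormedAlgebra

variable {V : Type*} [NormedAddCommGroup V] [InnerProductSpace ℂ V] [FiniteDimensional ℂ V]
  {τ : Representation ℂ SO3 V}

/-- Complex differentiability is what permits derivatives along Y₁ and Y₂ to be combined into one
along Y₁ + iY₂. -/
lemma differentiable_evalSymbol (M : PolySymbol V) :
    Differentiable ℂ fun ξ : Fin 3 → ℂ => evalSymbol ξ M := by
  induction M using PolySymbol.induction with
  | zero => simp only [map_zero]; exact differentiable_const _
  | add M N hM hN => simp only [map_add]; exact hM.add hN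
  | smul f T =>
    simp only [evalSymbol_smul, evalSymbol_constSymbol]
    refine Differentiable.smul_const ?_ T
    induction f using MvPolynomial.induction_on with
    | C a => simp only [eval_C]; exact differentiable_const _
    | add p q hp hq => simp only [map_add]; exact hp.add hq
    | mul_X p i hp => simp only [map_mul, eval_X]; exact hp.mul (differentiable_apply i)

/-- The infinitesimal action of the canonical basis of `so(3)` on `ℂ³`. -/
def basisActC (i : Fin 3) (ξ : Fin 3 → ℂ) : Fin 3 → ℂ := fun a => ∑ b, (basisMatrix i a b : ℂ) * ξ b

lemma hasDerivAt_rotateC_expSO3 (i : Fin 3) (ξ : Fin 3 → ℂ) :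
    HasDerivAt (fun t : ℝ => rotateC (expSO3 (t • basisY i)) ξ) (basisActC i ξ) 0 := by
  refine hasDerivAt_pi.2 fun a => HasDerivAt.fun_sum fun b _ => ?_
  have h := hasDerivAt_matrix_exp_smul (basisMatrix i) 0
  rw [zero_smul, NormedSpace.exp_zero, mul_one] at h
  have h' : HasDerivAt (fun t : ℝ => (expSO3 (t • basisY i)).1 a b) (basisMatrix i a b) 0 :=
    hasDerivAt_pi.1 (hasDerivAt_pi.1 h a) b
  exact h'.ofReal_comp.mul_const (ξ b)

lemma rotateC_one (ξ : Fin 3 → ℂ) : rotateC 1 ξ = ξ := by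
  funext a
  simp [rotateC, Matrix.one_apply, apply_ite]

/-- The infinitesimal form of equivariance. -/
lemma IsEquivariant.fderiv_basisActC (hc : ∀ v : V, Continuous fun k : SO3 => τ k v)
    {M : PolySymbol V} (hM : IsEquivariant τ M) (i : Fin 3) (ξ : Fin 3 → ℂ) :
    fderiv ℂ (fun ξ => evalSymbol ξ M) ξ (basisActC i ξ) =
      derivedRep τ (basisY i) * evalSymbol ξ M - evalSymbol ξ M * derivedRep τ (basisY i) := by
  have hE := hasDerivAt_opOf_expSO3 hc (basisY i)
  have hz : expSO3 ((0 : ℝ) • basisY i) = 1 := by rw [zero_smul, expSO3_zero]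
  have hd : HasDerivAt (fun t : ℝ => evalSymbol (rotateC (expSO3 (t • basisY i)) ξ) M)
      (fderiv ℂ (fun ξ => evalSymbol ξ M) ξ (basisActC i ξ)) 0 := by
    have h1 := ((differentiable_evalSymbol M ξ).hasFDerivAt.restrictScalars ℝ)
    have h2 := hasDerivAt_rotateC_expSO3 i ξ
    refine HasFDerivAt.comp_hasDerivAt_of_eq (0 : ℝ) h1 h2 ?_
    rw [hz, rotateC_one]
  have h := (hd.mul hE).unique ((hE.mul_const (evalSymbol ξ M)).congr_of_eventuallyEq
    (Filter.Eventually.of_forall fun t => hM.evalSymbol_rotateC _ ξ))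
  rw [hz, opOf_one, mul_one, rotateC_one] at h
  exact eq_sub_of_add_eq h

/-- Euler's identity. -/
lemma IsHomogeneousSymbol.fderiv_self {d : ℕ} {M : PolySymbol V} (hM : IsHomogeneousSymbol d M)
    (ξ : Fin 3 → ℂ) :
    fderiv ℂ (fun ξ => evalSymbol ξ M) ξ ξ = (d : ℂ) • evalSymbol ξ M := by
  have h1 : HasDerivAt (fun c : ℂ => c • ξ) ξ 1 := by
    simpa using (hasDerivAt_id (1 : ℂ)).smul_const ξ
  have h2 : HasDerivAt (fun c : ℂ => evalSymbol (c • ξ) M)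
      (fderiv ℂ (fun ξ => evalSymbol ξ M) ξ ξ) 1 :=
    HasFDerivAt.comp_hasDerivAt_of_eq (1 : ℂ) (differentiable_evalSymbol M ξ).hasFDerivAt h1
      (one_smul ℂ ξ).symm
  simp only [hM.evalSymbol_smul] at h2
  have h3 := (hasDerivAt_pow d (1 : ℂ)).smul_const (evalSymbol ξ M)
  simpa using h2.unique h3

/-- The value of an equivariant homogeneous symbol at the isotropic vector. -/
lemma IsEquivariant.evalSymbol_isotropicVec (hc : ∀ v : V, Continuous fun k : SO3 => τ k v)
    (hirr : τ.IsIrreducible) {M : PolySymbol V} (hM : IsEquivariant τ M) {d : ℕ}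
    (hd : IsHomogeneousSymbol d M) :
    ∃ c : ℂ, evalSymbol isotropicVec M = c • raisingOp τ ^ d := by
  set P := evalSymbol isotropicVec M with hP
  set L := fderiv ℂ (fun ξ => evalSymbol ξ M) isotropicVec
  have h0 := hM.fderiv_basisActC hc 0 isotropicVec
  have h1 := hM.fderiv_basisActC hc 1 isotropicVec
  have h2 := hM.fderiv_basisActC hc 2 isotropicVec
  -- The vector (1, i, 0) is a highest weight vector of ℂ³: Y₁ + iY₂ kills it, so P commutes with
  -- the raising operator, and Y₃ scales it by i, so Euler's identity gives P weight d.
  have a01 : basisActC 0 isotropicVec + Complex.I • basisActC 1 isotropicVec = 0 := by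
    funext a
    fin_cases a <;> simp [basisActC, isotropicVec, basisMatrix, Fin.sum_univ_three]
  have a2 : basisActC 2 isotropicVec = Complex.I • isotropicVec := by
    funext a
    fin_cases a <;> simp [basisActC, isotropicVec, basisMatrix, Fin.sum_univ_three]
  refine eq_smul_raisingOp_pow hc hirr ?_ ?_
  · have h := congrArg L a01
    rw [map_add, map_smul, map_zero, h0, h1] at h
    change P * raisingOp τ = raisingOp τ * P
    rw [eq_comm, ← sub_eq_zero, ← h, raisingOp, mul_add, add_mul, mul_smul_comm, smul_mul_assoc,
      smul_sub]
    abel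
  · rw [← h2, a2, map_smul, hd.fderiv_self, smul_smul, mul_comm]

/-- Equivariance spreads the vanishing over the rotations of (1, i, 0) and homogeneity over their
multiples, which exhaust the cone. -/
lemma IsEquivariant.eval_eq_zero_of_isotropic {M : PolySymbol V} (hM : IsEquivariant τ M) {d : ℕ}
    (hd : IsHomogeneousSymbol d M) (h0 : evalSymbol isotropicVec M = 0) (ξ : Fin 3 → ℂ)
    (hξ : ξ 0 ^ 2 + ξ 1 ^ 2 + ξ 2 ^ 2 = 0) : evalSymbol ξ M = 0 := by
  obtain ⟨k, c, rfl⟩ := exists_eq_smul_rotateC_isotropicVec ξ hξ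
  have h := hM.evalSymbol_rotateC k isotropicVec
  rw [h0, mul_zero] at h
  have h1 : evalSymbol (rotateC k isotropicVec) M = 0 := by
    rw [← mul_one (evalSymbol _ M), ← opOf_mul_inv (τ := τ) k, ← mul_assoc, h, zero_mul]
  rw [hd.evalSymbol_smul, h1, smul_zero]

end HighestWeight

/-! ### Induction on the degree -/

section Main

open MvPolynomial

variable {V : Type*} [NormedAddCommGroup V] [InnerProductSpace ℂ V] [FiniteDimensional ℂ V]
  {τ : Representation ℂ SO3 V}

/-- Subtracting a multiple of the d-th power of the symbol of D_τ makes M vanish on the cone; the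
difference is then the symbol of Δ times an equivariant symbol of degree d − 2. -/
lemma symbolOp_mem_adjoin_of_isHomogeneousSymbol (hc : ∀ v : V, Continuous fun k : SO3 => τ k v)
    (hirr : τ.IsIrreducible) (d : ℕ) : ∀ M : PolySymbol V, IsEquivariant τ M →
      IsHomogeneousSymbol d M → symbolOp M ∈ Algebra.adjoin ℂ {laplacianOp, Dtau τ} := by
  have := nontrivial_of_isIrreducible hirr
  induction d using Nat.strong_induction_on with
  | _ d ih =>
  intro M hM hd
  set S : Subalgebra ℂ (Module.End ℂ (SmoothFun V)) := Algebra.adjoin ℂ {laplacianOp, Dtau τ}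
  obtain ⟨c, hcE⟩ := hM.evalSymbol_isotropicVec hc hirr hd
  set N := M - c • dtauSymbol τ ^ d with hN
  have hNeq : IsEquivariant τ N := hM.sub_smul ((isEquivariant_dtauSymbol hc).pow d) c
  have hNhom : IsHomogeneousSymbol d N := hd.sub_smul (isHomogeneousSymbol_dtauSymbol_pow d) c
  have hN0 : evalSymbol isotropicVec N = 0 := by
    rw [hN, map_sub, map_smul, map_pow, evalSymbol_isotropicVec_dtauSymbol, hcE, sub_self]
  have hdvd : ∀ i j, normSqPoly ∣ N i j := fun i j =>
    normSqPoly_dvd_of_eval_eq_zero _ fun ξ hξ =>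
      eval_eq_zero_of_evalSymbol_eq_zero (hNeq.eval_eq_zero_of_isotropic hNhom hN0 ξ hξ) i j
  have hNmem : symbolOp N ∈ S := by
    -- Base cases: in degree 0 or 1 divisibility by the quadratic form forces N = 0.
    rcases lt_or_ge d 2 with hlt | hge
    · have : N = 0 := by
        ext1 i j
        exact eq_zero_of_isHomogeneous_of_normSqPoly_dvd hlt (hNhom i j) (hdvd i j)
      rw [this, map_zero]
      exact S.zero_mem
    · obtain ⟨e, rfl⟩ := Nat.exists_eq_add_of_le' hge
      choose g hg hNg using fun i j => exists_isHomogeneous_of_normSqPoly_dvd (hNhom i j) (hdvd i j)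
      have hNG : N = normSqPoly • (Matrix.of g : PolySymbol V) := by
        ext1 i j
        exact hNg i j
      have hG : symbolOp (Matrix.of g : PolySymbol V) ∈ S :=
        ih e (by omega) _ (IsEquivariant.of_normSqPoly_smul (hNG ▸ hNeq)) hg
      have hmul : N = (normSqPoly • (1 : PolySymbol V)) * Matrix.of g := by
        rw [hNG, smul_mul_assoc, one_mul]
      rw [hmul, map_mul, symbolOp_normSqPoly]
      exact S.mul_mem (Algebra.subset_adjoin (by simp)) hG
  have hMN : M = N + c • dtauSymbol τ ^ d := by rw [hN, sub_add_cancel]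
  rw [hMN, map_add, map_smul, map_pow, symbolOp_dtauSymbol]
  exact S.add_mem hNmem (S.smul_mem (S.pow_mem (Algebra.subset_adjoin (by simp)) d) c)

lemma symbolOp_mem_adjoin (hc : ∀ v : V, Continuous fun k : SO3 => τ k v)
    (hirr : τ.IsIrreducible) {M : PolySymbol V} (hM : IsEquivariant τ M) :
    symbolOp M ∈ Algebra.adjoin ℂ {laplacianOp, Dtau τ} := by
  set n := Finset.univ.sup fun p : Fin (Module.finrank ℂ V) × Fin (Module.finrank ℂ V) =>
    (M p.1 p.2).totalDegree
  have hsum : M = ∑ d ∈ Finset.range (n + 1), M.map (homogeneousComponent d) := by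
    ext1 i j
    have hle : (M i j).totalDegree ≤ n :=
      Finset.le_sup (f := fun p : Fin (Module.finrank ℂ V) × Fin (Module.finrank ℂ V) =>
        (M p.1 p.2).totalDegree) (Finset.mem_univ (i, j))
    rw [Matrix.sum_apply]
    simp only [Matrix.map_apply]
    conv_lhs => rw [← sum_homogeneousComponent (M i j)]
    refine Finset.sum_subset (Finset.range_subset_range.2 (by omega)) fun d _ hd => ?_
    exact homogeneousComponent_eq_zero _ _ (by rw [Finset.mem_range] at hd; omega)
  rw [hsum, map_sum]
  exact Subalgebra.sum_mem _ fun d _ => symbolOp_mem_adjoin_of_isHomogeneousSymbol hc hirr d _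
    (hM.map_homogeneousComponent d) fun i j => homogeneousComponent_isHomogeneous _ _

lemma IsEquivariant.symbolOp_mem_invariantDiffOps {M : PolySymbol V} (hM : IsEquivariant τ M) :
    symbolOp M ∈ invariantDiffOps τ := by
  refine Algebra.mem_inf.2 ⟨symbolOp_mem_diffOps M, (Subalgebra.mem_centralizer_iff ℂ).2 ?_⟩
  rintro _ (⟨y, rfl⟩ | ⟨k, rfl⟩)
  · exact (commute_symbolOp_translateOp M y).eq.symm
  · exact (hM.commute_rotateOp k).eq.symm

end Main

end EuclideanMotion

end

/-- For every irreducible unitary representation `τ` of `SO(3)`, the algebra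
`(𝔻(ℝ³) ⊗ End(V))^{SO(3)}` is generated by `Δ ⊗ I` and `D_τ`. -/
theorem theorem1 {V : Type*} [NormedAddCommGroup V] [InnerProductSpace ℂ V]
    [FiniteDimensional ℂ V] (τ : Representation ℂ EuclideanMotion.SO3 V)
    (hτ : EuclideanMotion.IsIrreducibleUnitary τ) :
    EuclideanMotion.invariantDiffOps τ =
      Algebra.adjoin ℂ {EuclideanMotion.laplacianOp, EuclideanMotion.Dtau τ} := by
  have := EuclideanMotion.nontrivial_of_isIrreducible hτ.irreducible
  refine le_antisymm (fun D hD => ?_) (Algebra.adjoin_le ?_)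
  · obtain ⟨hdiff, hcomm⟩ := Algebra.mem_inf.1 hD
    rw [Subalgebra.mem_centralizer_iff] at hcomm
    obtain ⟨M, rfl⟩ := EuclideanMotion.exists_symbol_of_commute_translateOp hdiff
      fun y => (hcomm _ (Or.inl ⟨y, rfl⟩)).symm
    exact EuclideanMotion.symbolOp_mem_adjoin hτ.continuous hτ.irreducible
      (EuclideanMotion.isEquivariant_of_commute_rotateOp fun k => (hcomm _ (Or.inr ⟨k, rfl⟩)).symm)
  · rintro _ (rfl | rfl)
    · rw [← EuclideanMotion.symbolOp_normSqPoly]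
      exact EuclideanMotion.isEquivariant_normSqPoly.symbolOp_mem_invariantDiffOps
    · rw [← EuclideanMotion.symbolOp_dtauSymbol]
      exact (EuclideanMotion.isEquivariant_dtauSymbol hτ.continuous).symbolOp_mem_invariantDiffOps
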